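/- Let $f(m)=1+\frac{12}{7}\bigl(m\log m+(1-m)\log(1-m)\bigr)$ and $g(t)=1+2t\log t+2(1-t)\log(1-t)$ for $m,t\in(0,1)$. Let $M$ be the median of three independent random variables uniform on $(0,1)$, and let $U$ be uniform on $(0,1)$. Let $X^{(mtqs)}$ be the limit of the normalized number of key comparisons of median-of-three Quicksort, that is, a real random variable with mean $0$ and finite variance satisfying $$X^{(mtqs)}\stackrel{d}{=}M X_1+(1-M)X_2+f(M),$$ where $X_1,X_2$ are copies of $X^{(mtqs)}$ and $M,X_1,X_2$ are independent. Then $$\lim_{x\to\infty}\frac{\log\mathbb P[X^{(mtqs)}>x]}{x\log x}=-2\qquad\text{and}\qquad \limsup_{x\to\infty}\frac{\log\mathbb P[X^{(mtqs)}<-x]}{x\log x}\le-\frac{14}{12\log 2-7},$$ where $\log 0=-\infty$ and the limit superior is taken in $[-\infty,\infty]$. Moreover, both tails are asymptotically thinner than those of standard Quicksort: if $X^{(qs)}$ is a real random variable with mean $0$ and finite variance satisfying $X^{(qs)}\stackrel{d}{=}U Y_1+(1-U)Y_2+g(U)$, where $Y_1,Y_2$ are copies of $X^{(qs)}$ and $U,Y_1,Y_2$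 are independent, then, as $x\to\infty$, $$\mathbb P[X^{(mtqs)}>x]=o\bigl(\mathbb P[X^{(qs)}>x]\bigr)\qquad\text{and}\qquad \mathbb P[X^{(mtqs)}<-x]=o\bigl(\mathbb P[X^{(qs)}<-x]\bigr).$$ -/

import Mathlib

open MeasureTheory Filter Topology Asymptotics Set

noncomputable section

/-- The uniform distribution on the interval (0, 1). -/
def uniformLaw : Measure ℝ := volume.restrict (Ioo (0 : ℝ) 1)

/-- The median of three real numbers. -/
def median3 (a b c : ℝ) : ℝ := max (min a b) (min (max a b) c)

/-- The law of the median of three independent uniform (0, 1) random variables. -/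
def medianLaw : Measure ℝ :=
  (Measure.pi fun _ : Fin 3 => uniformLaw).map fun u => median3 (u 0) (u 1) (u 2)

/-- The toll function of Quicksort. -/
def quicksortToll (t : ℝ) : ℝ :=
  2 * t * Real.log t + 2 * (1 - t) * Real.log (1 - t) + 1

/-- The toll function of median-of-three Quicksort. -/
def medianQuicksortToll (m : ℝ) : ℝ :=
  1 + 12 / 7 * (m * Real.log m + (1 - m) * Real.log (1 - m))

/-- The smoothing transform of the law `F`: the law of `V * X₁ + (1 - V) * X₂ + c V`, where `V`
has law `pivot`, both `X₁` and `X₂` have law `F`, and `V`, `X₁`, `X₂` are independent. -/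
def smoothing (pivot : Measure ℝ) (c : ℝ → ℝ) (F : Measure ℝ) : Measure ℝ :=
  (pivot.prod (F.prod F)).map fun p => p.1 * p.2.1 + (1 - p.1) * p.2.2 + c p.1

/-- `F` is a probability distribution on the real line with mean zero and finite variance that
is a fixed point of the smoothing transform given by `pivot` and `c`. -/
structure IsCenteredFixedPoint (pivot : Measure ℝ) (c : ℝ → ℝ) (F : Measure ℝ) : Prop where
  isProbabilityMeasure : IsProbabilityMeasure F
  memLp_two : MemLp (fun x : ℝ => x) 2 F
  mean_eq_zero : ∫ x, x ∂F = 0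
  fixed : smoothing pivot c F = F

/-- `F` is the Quicksort distribution. -/
def IsQuicksortLaw (F : Measure ℝ) : Prop :=
  IsCenteredFixedPoint uniformLaw quicksortToll F

/-- `F` is the median-of-three Quicksort distribution. -/
def IsMedianQuicksortLaw (F : Measure ℝ) : Prop :=
  IsCenteredFixedPoint medianLaw medianQuicksortToll F

end

/-! Upper tails come from Chernoff bounds with explicit supersolutions `K` of the fixed-point
recursion for the log-Laplace transform (`IsCenteredFixedPoint.measureReal_lt_mul_le`). Exponential
moments of the fixed point are not known beforehand, so the bound is proved for the iterates started
at the Dirac mass at zero. It passes to the limit because a coupling with the fixed point contracts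
in mean square.

On the right, `K t = D * (exp (t / 2) - 1)` works because the median has density `6 m (1 - m)`,
vanishing linearly at the endpoints; the choice `t = 2 log x` gives `exp (-2 x log x + D x)`. On the
left, `K t = t log (1 + D t) / 2` gives the doubly exponential bound `exp (-η exp (2 x))`, far below
every `exp (-G x log x)`.

Lower tails come from restricting to favourable pivots. A pivot within order `1 / x` of one, of
probability of order `x ^ (-k)` (`k = 2` for the median, `k = 1` for the uniform law), moves the
right tail by almost one unit; iteration yields `exp (-θ x log x)` for every `θ > k`. For Quicksort,
pivots near one half move both subproblems left at once, and the left tail is at least `exp (-B exp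
(γ x))` with `γ < 2`. Comparing exponents gives both little-o claims. -/

/-- The map whose law under `V`, `X₁`, `X₂` is the smoothing transform. -/
def smoothingMap (c : ℝ → ℝ) (p : ℝ × ℝ × ℝ) : ℝ := p.1 * p.2.1 + (1 - p.1) * p.2.2 + c p.1

/-- The smoothing transform of a coupling of two laws, with a common pivot. -/
noncomputable def coupledSmoothing (pivot : Measure ℝ) (c : ℝ → ℝ) (F : Measure (ℝ × ℝ)) :
    Measure (ℝ × ℝ) :=
  (pivot.prod (F.prod F)).map fun p =>
    (smoothingMap c (p.1, p.2.1.1, p.2.2.1), smoothingMap c (p.1, p.2.1.2, p.2.2.2))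

/-- The coupling of a fixed point with the iterated smoothing transform of the Dirac mass at zero. -/
noncomputable def iteratedCoupling (pivot : Measure ℝ) (c : ℝ → ℝ) (F : Measure ℝ) :
    ℕ → Measure (ℝ × ℝ)
  | 0 => F.map fun x => (x, 0)
  | n + 1 => coupledSmoothing pivot c (iteratedCoupling pivot c F n)

/-- A pivot law: a probability measure carried by `(0, 1)`. -/
structure IsPivotLaw (μ : Measure ℝ) : Prop where
  isProbabilityMeasure : IsProbabilityMeasure μ
  ae_mem : ∀ᵐ m ∂μ, m ∈ Ioo (0 : ℝ) 1

/-! ### Mean-square contraction and the Chernoff bound for fixed points -/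

section

variable {μ : Measure ℝ} {c : ℝ → ℝ} {F : Measure ℝ}

theorem measurable_smoothingMap (hc : Measurable c) : Measurable (smoothingMap c) := by
  unfold smoothingMap; fun_prop

theorem measurable_coupledMap (hc : Measurable c) :
    Measurable fun p : ℝ × (ℝ × ℝ) × (ℝ × ℝ) =>
      (smoothingMap c (p.1, p.2.1.1, p.2.2.1), smoothingMap c (p.1, p.2.1.2, p.2.2.2)) := by
  unfold smoothingMap; fun_prop

theorem IsPivotLaw.integrable_of_continuous (hμ : IsPivotLaw μ) {φ : ℝ → ℝ} (hφ : Continuous φ) :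
    Integrable φ μ := by
  have := hμ.isProbabilityMeasure
  obtain ⟨C, hC⟩ := isCompact_Icc.exists_bound_of_continuousOn (s := Icc (0 : ℝ) 1)
    hφ.continuousOn
  refine Integrable.of_bound hφ.aestronglyMeasurable C ?_
  filter_upwards [hμ.ae_mem] with m hm using hC m (Ioo_subset_Icc_self hm)

theorem IsPivotLaw.integral_mul_one_sub_pos (hμ : IsPivotLaw μ) :
    0 < ∫ m, m * (1 - m) ∂μ := by
  have := hμ.isProbabilityMeasure
  rw [integral_pos_iff_support_of_nonneg_ae]
  · have h : ∀ᵐ m ∂μ, m ∈ Function.support fun m : ℝ => m * (1 - m) := by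
      filter_upwards [hμ.ae_mem] with m hm
      exact (mul_pos hm.1 (by linarith [hm.2])).ne'
    have h1 : μ (Function.support fun m : ℝ => m * (1 - m)) = μ univ :=
      measure_congr (eventuallyEq_univ.2 h)
    rw [h1]
    simp
  · filter_upwards [hμ.ae_mem] with m hm
    exact (mul_pos hm.1 (by linarith [hm.2])).le
  · exact hμ.integrable_of_continuous (by fun_prop)

/-- Integrals of affine combinations with independent weights. -/
theorem integral_affine_combination {α : Type*} [MeasurableSpace α] {G : Measure α}
    [IsProbabilityMeasure G] (hμ : IsPivotLaw μ) {D : α → ℝ} (hD : Integrable D G)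
    (hD0 : ∫ a, D a ∂G = 0) :
    Integrable (fun p : ℝ × α × α => p.1 * D p.2.1 + (1 - p.1) * D p.2.2) (μ.prod (G.prod G)) ∧
      ∫ p : ℝ × α × α, p.1 * D p.2.1 + (1 - p.1) * D p.2.2 ∂μ.prod (G.prod G) = 0 := by
  have := hμ.isProbabilityMeasure
  have i1 : Integrable (fun p : ℝ × α × α => p.1 * D p.2.1) (μ.prod (G.prod G)) :=
    (hμ.integrable_of_continuous continuous_id).mul_prod
      (g := fun q : α × α => D q.1) (hD.comp_fst G)
  have i2 : Integrable (fun p : ℝ × α × α => (1 - p.1) * D p.2.2) (μ.prod (G.prod G)) :=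
    (hμ.integrable_of_continuous (φ := fun m => 1 - m) (by fun_prop)).mul_prod
      (g := fun q : α × α => D q.2) (hD.comp_snd G)
  refine ⟨i1.add i2, ?_⟩
  rw [integral_add i1 i2,
    integral_prod_mul (fun m : ℝ => m) (fun q : α × α => D q.1),
    integral_prod_mul (fun m : ℝ => 1 - m) (fun q : α × α => D q.2),
    integral_fun_fst, integral_fun_snd, hD0]
  simp

/-- The cross term vanishes because the two copies are independent and centered, and `m ^ 2 + (1 -
m) ^ 2 = 1 - 2 m (1 - m)`. The resulting factor is the contraction rate of the coupling. -/
theorem integral_sq_affine_combination {α : Type*} [MeasurableSpace α] {G : Measure α}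
    [IsProbabilityMeasure G] (hμ : IsPivotLaw μ) {D : α → ℝ} (hD : MemLp D 2 G)
    (hD0 : ∫ a, D a ∂G = 0) :
    MemLp (fun p : ℝ × α × α => p.1 * D p.2.1 + (1 - p.1) * D p.2.2) 2 (μ.prod (G.prod G)) ∧
      ∫ p : ℝ × α × α, (p.1 * D p.2.1 + (1 - p.1) * D p.2.2) ^ 2 ∂μ.prod (G.prod G)
        = (1 - 2 * ∫ m, m * (1 - m) ∂μ) * ∫ a, D a ^ 2 ∂G := by
  have := hμ.isProbabilityMeasure
  have hD1 : Integrable D G := hD.integrable (by norm_num)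
  have hD2 : Integrable (fun a => D a ^ 2) G := hD.integrable_sq
  have j1 : Integrable (fun m : ℝ => m ^ 2) μ := hμ.integrable_of_continuous (by fun_prop)
  have j2 : Integrable (fun m : ℝ => 2 * (m * (1 - m))) μ :=
    hμ.integrable_of_continuous (by fun_prop)
  have j3 : Integrable (fun m : ℝ => (1 - m) ^ 2) μ := hμ.integrable_of_continuous (by fun_prop)
  have i1 : Integrable (fun p : ℝ × α × α => p.1 ^ 2 * D p.2.1 ^ 2) (μ.prod (G.prod G)) :=
    j1.mul_prod (g := fun q : α × α => D q.1 ^ 2) (hD2.comp_fst G)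
  have i2 : Integrable (fun p : ℝ × α × α => 2 * (p.1 * (1 - p.1)) * (D p.2.1 * D p.2.2))
      (μ.prod (G.prod G)) :=
    j2.mul_prod (g := fun q : α × α => D q.1 * D q.2) (hD1.mul_prod hD1)
  have i3 : Integrable (fun p : ℝ × α × α => (1 - p.1) ^ 2 * D p.2.2 ^ 2) (μ.prod (G.prod G)) :=
    j3.mul_prod (g := fun q : α × α => D q.2 ^ 2) (hD2.comp_snd G)
  have e : (fun p : ℝ × α × α => (p.1 * D p.2.1 + (1 - p.1) * D p.2.2) ^ 2) = fun p =>
      p.1 ^ 2 * D p.2.1 ^ 2 + 2 * (p.1 * (1 - p.1)) * (D p.2.1 * D p.2.2)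
        + (1 - p.1) ^ 2 * D p.2.2 ^ 2 := by
    funext p; ring
  have hm : (fun m : ℝ => m ^ 2 + (1 - m) ^ 2) = fun m => 1 - 2 * (m * (1 - m)) := by
    funext m; ring
  have hint : ∫ m, m ^ 2 ∂μ + ∫ m, (1 - m) ^ 2 ∂μ = 1 - 2 * ∫ m, m * (1 - m) ∂μ := by
    rw [← integral_add j1 j3, hm, integral_sub (integrable_const _) j2, integral_const_mul]
    simp
  constructor
  · rw [memLp_two_iff_integrable_sq (integral_affine_combination hμ hD1 hD0).1.1, e]
    exact (i1.add i2).add i3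
  · rw [e, integral_add (by exact i1.add i2) i3, integral_add i1 i2,
      integral_prod_mul (fun m : ℝ => m ^ 2) (fun q : α × α => D q.1 ^ 2),
      integral_prod_mul (fun m : ℝ => 2 * (m * (1 - m))) (fun q : α × α => D q.1 * D q.2),
      integral_prod_mul (fun m : ℝ => (1 - m) ^ 2) (fun q : α × α => D q.2 ^ 2),
      integral_prod_mul D D, integral_fun_fst (fun a => D a ^ 2),
      integral_fun_snd (fun a => D a ^ 2), hD0, ← hint]
    simp
    ring

/-- The toll function of a centered fixed point is centered. -/
theorem IsCenteredFixedPoint.integral_toll (hF : IsCenteredFixedPoint μ c F) (hμ : IsPivotLaw μ)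
    (hc : Continuous c) : ∫ m, c m ∂μ = 0 := by
  have := hμ.isProbabilityMeasure
  have := hF.isProbabilityMeasure
  have h := hF.mean_eq_zero
  obtain ⟨i, e⟩ := integral_affine_combination hμ (D := fun x : ℝ => x)
    (hF.memLp_two.integrable (by norm_num)) hF.mean_eq_zero
  have hm : Measurable fun p : ℝ × ℝ × ℝ => p.1 * p.2.1 + (1 - p.1) * p.2.2 + c p.1 :=
    measurable_smoothingMap hc.measurable
  rw [← hF.fixed, smoothing, integral_map hm.aemeasurable (by fun_prop), integral_add i ((hμ.integrable_of_continuous hc).comp_fst _), e,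
    integral_fun_fst] at h
  simpa using h

theorem coupledSmoothing_map_fst (hμ : IsPivotLaw μ) (hc : Measurable c)
    {G : Measure (ℝ × ℝ)} [IsProbabilityMeasure G] :
    (coupledSmoothing μ c G).map Prod.fst = smoothing μ c (G.map Prod.fst) := by
  have := hμ.isProbabilityMeasure
  have : IsProbabilityMeasure (G.map Prod.fst) :=
    Measure.isProbabilityMeasure_map measurable_fst.aemeasurable
  have e : μ.prod ((G.map Prod.fst).prod (G.map Prod.fst))
      = (μ.prod (G.prod G)).map (Prod.map id (Prod.map Prod.fst Prod.fst)) := by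
    rw [← Measure.map_prod_map _ _ measurable_id (measurable_fst.prodMap measurable_fst),
      ← Measure.map_prod_map _ _ measurable_fst measurable_fst, Measure.map_id]
  rw [coupledSmoothing, Measure.map_map measurable_fst (measurable_coupledMap hc), smoothing, e]
  have h2 : Measurable fun p : ℝ × ℝ × ℝ => p.1 * p.2.1 + (1 - p.1) * p.2.2 + c p.1 :=
    measurable_smoothingMap hc
  rw [Measure.map_map h2 (by fun_prop)]
  rfl

/-- Given the pivot, the exponent splits into a sum over independent copies, so the Laplace
transform factorizes. -/
theorem lintegral_exp_coupledSmoothing (hμ : IsPivotLaw μ) (hc : Measurable c)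
    {G : Measure (ℝ × ℝ)} [IsProbabilityMeasure G] (t : ℝ) :
    ∫⁻ y, ENNReal.ofReal (Real.exp (t * y.2)) ∂coupledSmoothing μ c G
      = ∫⁻ m, ENNReal.ofReal (Real.exp (t * c m))
          * ((∫⁻ y, ENNReal.ofReal (Real.exp (t * m * y.2)) ∂G)
            * ∫⁻ y, ENNReal.ofReal (Real.exp (t * (1 - m) * y.2)) ∂G) ∂μ := by
  have := hμ.isProbabilityMeasure
  rw [coupledSmoothing, lintegral_map (by fun_prop) (measurable_coupledMap hc),
    lintegral_prod _ (by unfold smoothingMap; fun_prop)]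
  refine lintegral_congr fun m => ?_
  have e : ∀ p : (ℝ × ℝ) × (ℝ × ℝ),
      ENNReal.ofReal (Real.exp (t * smoothingMap c (m, p.1.2, p.2.2)))
      = ENNReal.ofReal (Real.exp (t * c m)) *
        (ENNReal.ofReal (Real.exp (t * m * p.1.2))
          * ENNReal.ofReal (Real.exp (t * (1 - m) * p.2.2))) := by
    intro p
    rw [← ENNReal.ofReal_mul (Real.exp_nonneg _), ← ENNReal.ofReal_mul (Real.exp_nonneg _),
      ← Real.exp_add, ← Real.exp_add]
    congr 2
    unfold smoothingMap
    ring
  simp_rw [e]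
  rw [lintegral_const_mul _ (by fun_prop)]
  congr 1
  exact lintegral_prod_mul (f := fun y : ℝ × ℝ => ENNReal.ofReal (Real.exp (t * m * y.2)))
    (g := fun y : ℝ × ℝ => ENNReal.ofReal (Real.exp (t * (1 - m) * y.2)))
    (by fun_prop) (by fun_prop)

theorem isProbabilityMeasure_iteratedCoupling (hμ : IsPivotLaw μ) (hc : Measurable c)
    [IsProbabilityMeasure F] (n : ℕ) : IsProbabilityMeasure (iteratedCoupling μ c F n) := by
  have := hμ.isProbabilityMeasure
  induction n with
  | zero => exact Measure.isProbabilityMeasure_map (by fun_prop)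
  | succ n ih =>
    exact Measure.isProbabilityMeasure_map (measurable_coupledMap hc).aemeasurable

theorem iteratedCoupling_map_fst (hμ : IsPivotLaw μ) (hc : Measurable c)
    (hF : IsCenteredFixedPoint μ c F) (n : ℕ) :
    (iteratedCoupling μ c F n).map Prod.fst = F := by
  have := hF.isProbabilityMeasure
  induction n with
  | zero =>
    rw [iteratedCoupling, Measure.map_map measurable_fst (by fun_prop)]
    exact Measure.map_id
  | succ n ih =>
    have := isProbabilityMeasure_iteratedCoupling (F := F) hμ hc n
    rw [iteratedCoupling, coupledSmoothing_map_fst hμ hc, ih, hF.fixed]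

/-- The common pivot cancels the toll in the difference of the coordinates, leaving a centered
affine combination whose second moment contracts at each step. -/
theorem iteratedCoupling_sq_dist (hμ : IsPivotLaw μ) (hc : Measurable c)
    (hF : IsCenteredFixedPoint μ c F) (n : ℕ) :
    MemLp (fun y : ℝ × ℝ => y.1 - y.2) 2 (iteratedCoupling μ c F n) ∧
      ∫ y : ℝ × ℝ, y.1 - y.2 ∂iteratedCoupling μ c F n = 0 ∧
      ∫ y : ℝ × ℝ, (y.1 - y.2) ^ 2 ∂iteratedCoupling μ c F n
        = (1 - 2 * ∫ m, m * (1 - m) ∂μ) ^ n * ∫ x, x ^ 2 ∂F := by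
  have := hF.isProbabilityMeasure
  induction n with
  | zero =>
    have hm : AEMeasurable (fun x : ℝ => (x, (0 : ℝ))) F := by fun_prop
    rw [iteratedCoupling, memLp_map_measure_iff (by fun_prop) hm,
      integral_map hm (by fun_prop), integral_map hm (by fun_prop)]
    refine ⟨?_, by simpa using hF.mean_eq_zero, by simp⟩
    convert hF.memLp_two using 1
    funext x
    simp
  | succ n ih =>
    have := isProbabilityMeasure_iteratedCoupling (F := F) hμ hc n
    obtain ⟨h1, h2, h3⟩ := ih
    have hm := (measurable_coupledMap hc).aemeasurable
      (μ := μ.prod ((iteratedCoupling μ c F n).prod (iteratedCoupling μ c F n)))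
    have a1 := integral_affine_combination hμ (h1.integrable (by norm_num)) h2
    have a2 := integral_sq_affine_combination hμ h1 h2
    have e : ∀ p : ℝ × (ℝ × ℝ) × (ℝ × ℝ),
        smoothingMap c (p.1, p.2.1.1, p.2.2.1) - smoothingMap c (p.1, p.2.1.2, p.2.2.2)
        = p.1 * (p.2.1.1 - p.2.1.2) + (1 - p.1) * (p.2.2.1 - p.2.2.2) := by
      intro p; unfold smoothingMap; ring
    rw [iteratedCoupling, coupledSmoothing, memLp_map_measure_iff (by fun_prop) hm,
      integral_map hm (by fun_prop), integral_map hm (by fun_prop)]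
    simp only [Function.comp_def, e]
    refine ⟨a2.1, a1.2, ?_⟩
    rw [a2.2, h3]
    ring

/-- The hypothesis `hKc` says that one smoothing step preserves the bound `exp ∘ K` on the Laplace
transform, and the Dirac mass at zero satisfies it since `K` is nonnegative. The sign of `s` selects
the tail. -/
theorem lintegral_exp_iteratedCoupling_le (hμ : IsPivotLaw μ) (hc : Measurable c)
    [IsProbabilityMeasure F] {K : ℝ → ℝ} (hK : ∀ t, 0 ≤ t → 0 ≤ K t) (s : ℝ)
    (hKc : ∀ t, 0 ≤ t → ∫⁻ m, ENNReal.ofReal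
      (Real.exp (K (t * m) + K (t * (1 - m)) - K t + t * (s * c m))) ∂μ ≤ 1) (n : ℕ) :
    ∀ t, 0 ≤ t → ∫⁻ y, ENNReal.ofReal (Real.exp (s * t * y.2)) ∂iteratedCoupling μ c F n
      ≤ ENNReal.ofReal (Real.exp (K t)) := by
  induction n with
  | zero =>
    intro t ht
    rw [iteratedCoupling, lintegral_map (by fun_prop) (by fun_prop)]
    simpa using hK t ht
  | succ n ih =>
    intro t ht
    have := isProbabilityMeasure_iteratedCoupling (F := F) hμ hc n
    rw [iteratedCoupling, lintegral_exp_coupledSmoothing hμ hc]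
    calc _ ≤ ∫⁻ m, ENNReal.ofReal (Real.exp (K t)) * ENNReal.ofReal
          (Real.exp (K (t * m) + K (t * (1 - m)) - K t + t * (s * c m))) ∂μ := by
          refine lintegral_mono_ae ?_
          filter_upwards [hμ.ae_mem] with m hm
          have h1 := ih (t * m) (mul_nonneg ht hm.1.le)
          have h2 := ih (t * (1 - m)) (mul_nonneg ht (by linarith [hm.2]))
          rw [← mul_assoc s t] at h1 h2
          refine (mul_le_mul_right (mul_le_mul' h1 h2) _).trans (le_of_eq ?_)
          rw [← ENNReal.ofReal_mul (Real.exp_nonneg _), ← ENNReal.ofReal_mul (Real.exp_nonneg _),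
            ← ENNReal.ofReal_mul (Real.exp_nonneg _), ← Real.exp_add, ← Real.exp_add,
            ← Real.exp_add]
          congr 2
          ring
      _ ≤ ENNReal.ofReal (Real.exp (K t)) * 1 := by
          rw [lintegral_const_mul' _ _ ENNReal.ofReal_ne_top]
          gcongr
          exact hKc t ht
      _ = _ := mul_one _

/-- A Chernoff bound for fixed points of a smoothing transform. -/
theorem IsCenteredFixedPoint.measureReal_lt_mul_le (hμ : IsPivotLaw μ) (hc : Measurable c)
    (hF : IsCenteredFixedPoint μ c F) {K : ℝ → ℝ} (hK : ∀ t, 0 ≤ t → 0 ≤ K t) (s : ℝ)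
    (hKc : ∀ t, 0 ≤ t → ∫⁻ m, ENNReal.ofReal
      (Real.exp (K (t * m) + K (t * (1 - m)) - K t + t * (s * c m))) ∂μ ≤ 1)
    {t : ℝ} (ht : 0 ≤ t) (x : ℝ) :
    F.real {y | x < s * y} ≤ Real.exp (-(t * x) + K t) := by
  have := hF.isProbabilityMeasure
  have := hμ.isProbabilityMeasure
  set κ := 1 - 2 * ∫ m, m * (1 - m) ∂μ with hκ
  set V := ∫ x, x ^ 2 ∂F
  have hκ1 : κ < 1 := by linarith [hμ.integral_mul_one_sub_pos]
  have hκ0 : 0 ≤ κ := by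
    have : ∫ m, m * (1 - m) ∂μ ≤ ∫ _, (1 / 4 : ℝ) ∂μ := by
      refine integral_mono (hμ.integrable_of_continuous (by fun_prop)) (integrable_const _) ?_
      intro m
      simp only
      nlinarith [sq_nonneg (m - 1 / 2)]
    simp at this
    linarith
  have chernoff : ∀ n x, (iteratedCoupling μ c F n).real {y | x ≤ s * y.2}
      ≤ Real.exp (-(t * x) + K t) := by
    intro n x
    have := isProbabilityMeasure_iteratedCoupling (F := F) hμ hc n
    have h1 := lintegral_exp_iteratedCoupling_le (F := F) hμ hc hK s hKc n t ht
    have h2 : ENNReal.ofReal (Real.exp (t * x)) * iteratedCoupling μ c F n {y | x ≤ s * y.2}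
        ≤ ENNReal.ofReal (Real.exp (K t)) := by
      refine le_trans ?_ h1
      refine le_trans ?_ (mul_meas_ge_le_lintegral₀ (by fun_prop)
        (ENNReal.ofReal (Real.exp (t * x))))
      gcongr with y
      intro hx
      refine ENNReal.ofReal_le_ofReal (Real.exp_le_exp.2 ?_)
      calc t * x ≤ t * (s * y.2) := mul_le_mul_of_nonneg_left hx ht
        _ = _ := by ring
    rw [← ofReal_measureReal (by finiteness), ← ENNReal.ofReal_mul (Real.exp_nonneg _),
      ENNReal.ofReal_le_ofReal_iff (Real.exp_nonneg _)] at h2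
    rw [Real.exp_add, Real.exp_neg, inv_mul_eq_div, le_div_iff₀ (Real.exp_pos _)]
    linarith
  -- If the first coordinate exceeds the level, either the second exceeds the level lowered by `ε`,
  -- or the two differ by at least `ε`. Chebyshev's inequality kills the second event as `n` grows;
  -- afterwards `ε` tends to zero.
  have key : ∀ ε, 0 < ε → F.real {y | x < s * y} ≤ Real.exp (-(t * (x - ε)) + K t) := by
    intro ε hε
    have hn : ∀ n : ℕ, F.real {y | x < s * y}
        ≤ Real.exp (-(t * (x - ε)) + K t) + s ^ 2 * (κ ^ n * V) / ε ^ 2 := by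
      intro n
      have := isProbabilityMeasure_iteratedCoupling (F := F) hμ hc n
      obtain ⟨h1, -, h3⟩ := iteratedCoupling_sq_dist hμ hc hF n
      have hm : F.real {y | x < s * y} = (iteratedCoupling μ c F n).real {y | x < s * y.1} := by
        conv_lhs => rw [← iteratedCoupling_map_fst hμ hc hF n]
        rw [map_measureReal_apply measurable_fst (measurableSet_lt (by fun_prop) (by fun_prop))]
        rfl
      have hsub : {y : ℝ × ℝ | x < s * y.1} ⊆
          {y | x - ε ≤ s * y.2} ∪ {y | ε ^ 2 ≤ s ^ 2 * (y.1 - y.2) ^ 2} := by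
        intro y hy
        simp only [mem_ofPred_eq, mem_union] at hy ⊢
        by_contra! h
        have : ε ≤ s * (y.1 - y.2) := by linarith [h.1]
        have : ε ^ 2 ≤ (s * (y.1 - y.2)) ^ 2 := by gcongr
        rw [mul_pow] at this
        linarith [h.2]
      have hmark := mul_meas_ge_le_integral_of_nonneg (μ := iteratedCoupling μ c F n)
        (f := fun y : ℝ × ℝ => s ^ 2 * (y.1 - y.2) ^ 2)
        (Eventually.of_forall fun y => by positivity) (h1.integrable_sq.const_mul _) (ε ^ 2)
      rw [integral_const_mul, h3] at hmark
      rw [hm]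
      refine (measureReal_mono hsub).trans ((measureReal_union_le _ _).trans ?_)
      gcongr
      · exact chernoff n _
      · rw [le_div_iff₀ (by positivity)]
        linarith
    have hlim : Tendsto (fun n : ℕ => Real.exp (-(t * (x - ε)) + K t) + s ^ 2 * (κ ^ n * V) / ε ^ 2)
        atTop (𝓝 (Real.exp (-(t * (x - ε)) + K t) + s ^ 2 * (0 * V) / ε ^ 2)) := by
      have := tendsto_pow_atTop_nhds_zero_of_lt_one hκ0 hκ1
      exact ((((this.mul_const V).const_mul _).div_const _).const_add _)
    have := ge_of_tendsto' hlim hn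
    simpa using this
  have hlim : Tendsto (fun ε : ℝ => Real.exp (-(t * (x - ε)) + K t)) (𝓝[>] 0)
      (𝓝 (Real.exp (-(t * (x - 0)) + K t))) := by
    refine Tendsto.mono_left ?_ nhdsWithin_le_nhds
    exact Continuous.tendsto (by fun_prop) _
  rw [sub_zero] at hlim
  refine ge_of_tendsto hlim ?_
  filter_upwards [self_mem_nhdsWithin] with ε hε using key ε hε

end

/-! ### The uniform law and the law of the median -/

instance isProbabilityMeasure_uniformLaw : IsProbabilityMeasure uniformLaw :=
  ⟨by simp [uniformLaw]⟩

theorem le_uniformLaw_Icc_one_sub {δ : ℝ} (h1 : δ ≤ 1) :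
    ENNReal.ofReal δ ≤ uniformLaw (Icc (1 - δ) 1) := by
  have : Ioo (1 - δ) 1 ⊆ Icc (1 - δ) 1 ∩ Ioo 0 1 := fun x hx =>
    ⟨Ioo_subset_Icc_self hx, by linarith [hx.1], hx.2⟩
  rw [uniformLaw, Measure.restrict_apply measurableSet_Icc]
  refine le_trans (le_of_eq ?_) (measure_mono this)
  simp

theorem uniformLaw_Iic {m : ℝ} (hm : m ∈ Ioo (0 : ℝ) 1) :
    uniformLaw (Iic m) = ENNReal.ofReal m := by
  have : Iic m ∩ Ioo 0 1 = Ioc 0 m := by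
    ext x; simp; grind
  rw [uniformLaw, Measure.restrict_apply measurableSet_Iic, this]
  simp

theorem uniformLaw_Ici {m : ℝ} (hm : m ∈ Ioo (0 : ℝ) 1) :
    uniformLaw (Ici m) = ENNReal.ofReal (1 - m) := by
  have : Ici m ∩ Ioo 0 1 = Ico m 1 := by
    ext x; simp; grind
  rw [uniformLaw, Measure.restrict_apply measurableSet_Ici, this]
  simp

theorem measurable_median3 : Measurable fun u : Fin 3 → ℝ => median3 (u 0) (u 1) (u 2) := by
  unfold median3; fun_prop

/-- The pairs `(m, r)` such that the two coordinates of `r` lie on different sides of `m`. -/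
def straddle (j : Fin 2) : Set (ℝ × (Fin 2 → ℝ)) := {p | p.2 j ≤ p.1 ∧ p.1 ≤ p.2 (1 - j)}

theorem measurableSet_straddle (j : Fin 2) : MeasurableSet (straddle j) :=
  (measurableSet_le (f := fun p : ℝ × (Fin 2 → ℝ) => p.2 j) (by fun_prop) measurable_fst).inter
    (measurableSet_le (g := fun p : ℝ × (Fin 2 → ℝ) => p.2 (1 - j)) measurable_fst (by fun_prop))

theorem exists_mem_straddle (u : Fin 3 → ℝ) :
    ∃ (i : Fin 3) (j : Fin 2), MeasurableEquiv.piFinSuccAbove (fun _ => ℝ) i u ∈ straddle j ∧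
      median3 (u 0) (u 1) (u 2) = u i := by
  have h (i : Fin 3) (j : Fin 2) : MeasurableEquiv.piFinSuccAbove (fun _ => ℝ) i u ∈ straddle j ↔
      u (i.succAbove j) ≤ u i ∧ u i ≤ u (i.succAbove (1 - j)) := Iff.rfl
  simp only [h, Fin.exists_fin_succ, median3]
  simp [Fin.succAbove]
  grind

/-- Given that coordinate `i` equals `m`, the other two lie on prescribed sides of it with
probability `m * (1 - m)`. -/
theorem lintegral_straddle (i : Fin 3) (j : Fin 2) {φ : ℝ → ENNReal} (hφ : Measurable φ) :
    ∫⁻ u, (straddle j).indicator (fun p => φ p.1) (MeasurableEquiv.piFinSuccAbove (fun _ => ℝ) i u)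
      ∂(Measure.pi fun _ : Fin 3 => uniformLaw)
      = ∫⁻ m in Ioo (0 : ℝ) 1, ENNReal.ofReal (m * (1 - m)) * φ m := by
  have hm : Measurable ((straddle j).indicator fun p : ℝ × (Fin 2 → ℝ) => φ p.1) :=
    (hφ.comp measurable_fst).indicator (measurableSet_straddle j)
  have h1 := (measurePreserving_piFinSuccAbove (fun _ : Fin 3 => uniformLaw) i).lintegral_comp hm
  refine h1.trans ?_
  rw [lintegral_prod _ hm.aemeasurable]
  refine setLIntegral_congr_fun measurableSet_Ioo fun m hmem => ?_
  have h2 : ∀ r : Fin 2 → ℝ, (straddle j).indicator (fun p => φ p.1) (m, r)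
      = (univ.pi fun k => if k = j then Iic m else Ici m).indicator (fun _ => φ m) r := by
    intro r
    refine indicator_eq_indicator ?_ rfl
    fin_cases j <;> simp [straddle, and_comm]
  simp_rw [h2]
  rw [lintegral_indicator_const (MeasurableSet.univ_pi fun k => by
    split_ifs <;> simp [measurableSet_Iic, measurableSet_Ici]), Measure.pi_pi, mul_comm,
    ENNReal.ofReal_mul hmem.1.le, ← uniformLaw_Iic hmem, ← uniformLaw_Ici hmem, Fin.prod_univ_two]
  fin_cases j <;> simp [mul_comm]

/-- The factor six counts the choices of the median coordinate and of the one below it. These events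
cover everything but overlap at ties, so a union bound gives the inequality, which is all the upper
tails need. -/
theorem lintegral_medianLaw_le {φ : ℝ → ENNReal} (hφ : Measurable φ) :
    ∫⁻ m, φ m ∂medianLaw ≤ 6 * ∫⁻ m in Ioo (0 : ℝ) 1, ENNReal.ofReal (m * (1 - m)) * φ m := by
  rw [medianLaw, lintegral_map hφ measurable_median3]
  calc _ ≤ ∫⁻ u, ∑ i : Fin 3, ∑ j : Fin 2, (straddle j).indicator (fun p => φ p.1)
        (MeasurableEquiv.piFinSuccAbove (fun _ => ℝ) i u)
        ∂(Measure.pi fun _ : Fin 3 => uniformLaw) := by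
        refine lintegral_mono fun u => ?_
        obtain ⟨i, j, hij, e⟩ := exists_mem_straddle u
        rw [e]
        refine le_trans ?_ (Finset.single_le_sum (fun _ _ => zero_le) (Finset.mem_univ i))
        refine le_trans ?_ (Finset.single_le_sum (fun _ _ => zero_le) (Finset.mem_univ j))
        rw [indicator_of_mem hij]
        exact le_rfl
    _ = _ := by
        have hm : ∀ (i : Fin 3) (j : Fin 2), Measurable fun u : Fin 3 → ℝ =>
            (straddle j).indicator (fun p => φ p.1)
              (MeasurableEquiv.piFinSuccAbove (fun _ => ℝ) i u) := fun i j =>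
          ((hφ.comp measurable_fst).indicator (measurableSet_straddle j)).comp
            (MeasurableEquiv.measurable _)
        rw [lintegral_finsetSum _ fun i _ => Finset.measurable_fun_sum _ fun j _ => hm i j]
        simp_rw [lintegral_finsetSum _ fun j _ => hm _ j, lintegral_straddle _ _ hφ]
        simp [← mul_assoc]
        norm_num

instance isProbabilityMeasure_medianLaw : IsProbabilityMeasure medianLaw :=
  Measure.isProbabilityMeasure_map measurable_median3.aemeasurable

theorem isPivotLaw_medianLaw : IsPivotLaw medianLaw := by
  refine ⟨inferInstance, ?_⟩
  have h := lintegral_medianLaw_le (φ := indicator (Ioo (0 : ℝ) 1)ᶜ 1)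
    (measurable_one.indicator measurableSet_Ioo.compl)
  rw [lintegral_indicator_one measurableSet_Ioo.compl, setLIntegral_congr_fun measurableSet_Ioo
    (g := fun _ => 0) (fun m hm => by simp [hm.1, hm.2])] at h
  exact le_antisymm (h.trans (by rw [lintegral_zero, mul_zero])) zero_le

/-- Two of the three points in the interval already force the median into it. The square is the
source of the constant `2` in the right-tail lower bound. -/
theorem le_medianLaw_Icc_one_sub {δ : ℝ} (h0 : 0 ≤ δ) (h1 : δ ≤ 1) :
    ENNReal.ofReal (δ ^ 2) ≤ medianLaw (Icc (1 - δ) 1) := by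
  have h := measure_mono (μ := Measure.pi fun _ : Fin 3 => uniformLaw)
    (s := univ.pi ![Icc (1 - δ) 1, Icc (1 - δ) 1, univ])
    (t := (fun u => median3 (u 0) (u 1) (u 2)) ⁻¹' Icc (1 - δ) 1) (by
      intro u hu
      have a := hu 0 (mem_univ _)
      have b := hu 1 (mem_univ _)
      simp [median3] at a b ⊢
      grind)
  rw [Measure.pi_pi, Fin.prod_univ_three] at h
  rw [medianLaw, Measure.map_apply measurable_median3 measurableSet_Icc]
  refine le_trans ?_ h
  simpa [sq, ENNReal.ofReal_mul h0] using
    mul_le_mul' (le_uniformLaw_Icc_one_sub h1) (le_uniformLaw_Icc_one_sub h1)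

/-! ### Exponents near zero and the toll functions -/

/-- For small `t` a quadratic exponent suffices: the linear term integrates to zero because the toll
is centered, and the negative term outweighs the second-order error. -/
theorem IsPivotLaw.exists_lintegral_exp_le_one {μ : Measure ℝ} (hμ : IsPivotLaw μ) {c : ℝ → ℝ}
    (hc : Continuous c) (hc1 : ∀ m ∈ Ioo (0 : ℝ) 1, |c m| ≤ 1) (hc0 : ∫ m, c m ∂μ = 0) :
    ∃ A > 0, ∃ t₀ > 0, ∀ t, |t| ≤ t₀ →
      ∫⁻ m, ENNReal.ofReal (Real.exp (-(A * t ^ 2 * (m * (1 - m))) + t * c m)) ∂μ ≤ 1 := by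
  have := hμ.isProbabilityMeasure
  set v := ∫ m, m * (1 - m) ∂μ with hv
  have hv0 : 0 < v := hμ.integral_mul_one_sub_pos
  -- With this constant `B * v = 4 * t ^ 2`, so the integrated bound is `1 + 2 t ^ 2 - 3 t ^ 2`. The
  -- cutoffs keep the exponent within the range of the quadratic estimate for `exp`.
  refine ⟨4 / v, by positivity, min (1 / 2) (Real.sqrt (v / 8)), by positivity, fun t ht => ?_⟩
  have ht1 : |t| ≤ 1 / 2 := ht.trans (min_le_left _ _)
  have ht2 : 4 / v * t ^ 2 ≤ 1 / 2 := by
    have : t ^ 2 ≤ v / 8 := by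
      rw [← sq_abs, ← Real.sq_sqrt (show 0 ≤ v / 8 by positivity)]
      exact pow_le_pow_left₀ (abs_nonneg _) (ht.trans (min_le_right _ _)) 2
    rw [div_mul_eq_mul_div, div_le_iff₀ hv0]
    linarith
  set B := 4 / v * t ^ 2 with hB
  have hB0 : 0 ≤ B := by positivity
  have hpt : ∀ m ∈ Ioo (0 : ℝ) 1, Real.exp (-(B * (m * (1 - m))) + t * c m)
      ≤ 1 + t * c m + 2 * t ^ 2 - 3 / 4 * B * (m * (1 - m)) := by
    intro m hm
    have hz0 : 0 ≤ m * (1 - m) := mul_nonneg hm.1.le (by linarith [hm.2])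
    have hz1 : m * (1 - m) ≤ 1 / 4 := by nlinarith [sq_nonneg (m - 1 / 2)]
    have hw : |t * c m| ≤ 1 / 2 := by
      rw [abs_mul]
      calc |t| * |c m| ≤ 1 / 2 * 1 := by gcongr; exact hc1 m hm
        _ = 1 / 2 := by norm_num
    have hy0 : 0 ≤ B * (m * (1 - m)) := by positivity
    have hy1 : B * (m * (1 - m)) ≤ 1 / 8 := by
      calc B * (m * (1 - m)) ≤ 1 / 2 * (1 / 4) := by gcongr
        _ = 1 / 8 := by norm_num
    have h := Real.abs_exp_sub_one_sub_id_le (x := -(B * (m * (1 - m))) + t * c m) (by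
      rw [abs_le] at hw ⊢
      constructor <;> linarith [hw.1, hw.2])
    have hsq : (t * c m) ^ 2 ≤ t ^ 2 := by
      have h2 : c m ^ 2 ≤ 1 := (sq_le_one_iff_abs_le_one _).2 (hc1 m hm)
      rw [mul_pow]
      nlinarith [sq_nonneg t]
    have h3 := (abs_le.1 h).2
    nlinarith [sq_nonneg (B * (m * (1 - m)) + t * c m)]
  calc _ ≤ ∫⁻ m, ENNReal.ofReal (1 + t * c m + 2 * t ^ 2 - 3 / 4 * B * (m * (1 - m))) ∂μ := by
        refine lintegral_mono_ae ?_
        filter_upwards [hμ.ae_mem] with m hm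
        exact ENNReal.ofReal_le_ofReal (hpt m hm)
    _ = ENNReal.ofReal (∫ m, (1 + t * c m + 2 * t ^ 2 - 3 / 4 * B * (m * (1 - m))) ∂μ) := by
        rw [ofReal_integral_eq_lintegral_ofReal (hμ.integrable_of_continuous (by fun_prop))]
        filter_upwards [hμ.ae_mem] with m hm
        exact (Real.exp_pos _).le.trans (hpt m hm)
    _ ≤ 1 := by
        rw [← ENNReal.ofReal_one]
        refine ENNReal.ofReal_le_ofReal ?_
        rw [integral_sub (hμ.integrable_of_continuous (by fun_prop))
            (hμ.integrable_of_continuous (by fun_prop)),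
          integral_add (hμ.integrable_of_continuous (by fun_prop)) (integrable_const _),
          integral_add (integrable_const _) (hμ.integrable_of_continuous (by fun_prop)),
          integral_const_mul, integral_const_mul _ fun m : ℝ => m * (1 - m), hc0, ← hv]
        have : B * v = 4 * t ^ 2 := by rw [hB]; field_simp
        simp
        nlinarith [sq_nonneg t]

theorem medianQuicksortToll_eq (m : ℝ) :
    medianQuicksortToll m = 1 - 12 / 7 * Real.binEntropy m := by
  simp [medianQuicksortToll, Real.binEntropy]; ring

theorem quicksortToll_eq (m : ℝ) : quicksortToll m = 1 - 2 * Real.binEntropy m := by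
  simp [quicksortToll, Real.binEntropy]; ring

theorem continuous_medianQuicksortToll : Continuous medianQuicksortToll := by
  rw [funext medianQuicksortToll_eq]
  fun_prop

theorem continuous_quicksortToll : Continuous quicksortToll := by
  rw [funext quicksortToll_eq]
  fun_prop

theorem abs_medianQuicksortToll_le {m : ℝ} (hm : m ∈ Ioo (0 : ℝ) 1) :
    |medianQuicksortToll m| ≤ 1 := by
  have h1 := Real.binEntropy_nonneg hm.1.le hm.2.le
  have h2 := Real.binEntropy_le_log_two (p := m)
  have h3 := Real.log_two_lt_d9
  rw [medianQuicksortToll_eq, abs_le]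
  constructor <;> linarith

/-! ### Upper bound for the left tail -/

/-- The exponent `t log (1 + D t) / 2` bounds the log-Laplace transform on the negative side. -/
theorem exists_left_exponent {A t₀ : ℝ} (hA : 0 < A) (ht₀ : 0 < t₀)
    (hsmall : ∀ t, |t| ≤ t₀ → ∫⁻ m, ENNReal.ofReal
      (Real.exp (-(A * t ^ 2 * (m * (1 - m))) + t * medianQuicksortToll m)) ∂medianLaw ≤ 1) :
    ∃ D > 0, ∀ t, 0 ≤ t → ∫⁻ m, ENNReal.ofReal (Real.exp
      (1 / 2 * (t * m) * Real.log (1 + D * (t * m))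
        + 1 / 2 * (t * (1 - m)) * Real.log (1 + D * (t * (1 - m)))
        - 1 / 2 * t * Real.log (1 + D * t) + t * (-1 * medianQuicksortToll m))) ∂medianLaw ≤ 1 := by
  -- The summand `7 / t₀` makes `D * t ≤ 7` imply `t ≤ t₀`; the summand `8 * A` lets the logarithmic
  -- exponent dominate the quadratic one there, where `1 + D * t ≤ 8`.
  have hD : 0 < 8 * A + 7 / t₀ := by positivity
  refine ⟨8 * A + 7 / t₀, hD, fun t ht => ?_⟩
  set D := 8 * A + 7 / t₀ with hDdef
  rcases le_total (D * t) 7 with h | h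
  · have htt : |(-t)| ≤ t₀ := by
      rw [abs_neg, abs_of_nonneg ht]
      have h1 : 7 / t₀ * t ≤ D * t := by gcongr; linarith
      have h2 : 7 / t₀ * t ≤ 7 := h1.trans h
      rw [div_mul_eq_mul_div, div_le_iff₀ ht₀] at h2
      linarith
    refine le_trans (lintegral_mono_ae ?_) (hsmall (-t) htt)
    filter_upwards [isPivotLaw_medianLaw.ae_mem] with m hm
    refine ENNReal.ofReal_le_ofReal (Real.exp_le_exp.2 ?_)
    have key : ∀ u, 0 ≤ u → u ≤ 1 → u * Real.log (1 + D * (t * u))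
        ≤ u * Real.log (1 + D * t) - D * t / 8 * (u * (1 - u)) := by
      intro u hu hu1
      have hd : 0 ≤ D * t := by positivity
      have e1 : 0 < 1 + D * (t * u) := by positivity
      have h1 := Real.one_sub_inv_le_log_of_pos (show 0 < (1 + D * t) / (1 + D * (t * u)) by positivity)
      rw [Real.log_div (by positivity) (by positivity), inv_div] at h1
      have h2 : D * t / 8 * (1 - u) ≤ 1 - (1 + D * (t * u)) / (1 + D * t) := by
        have : 1 - (1 + D * (t * u)) / (1 + D * t) = D * t * (1 - u) / (1 + D * t) := by
          field_simp; ring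
        rw [this, div_mul_eq_mul_div]
        exact div_le_div_of_nonneg_left (mul_nonneg hd (by linarith)) (by positivity) (by linarith)
      nlinarith
    have k1 := key m hm.1.le hm.2.le
    have k2 := key (1 - m) (by linarith [hm.2]) (by linarith [hm.1])
    have k3 : A * t ^ 2 * (m * (1 - m)) ≤ D * t ^ 2 / 8 * (m * (1 - m)) := by
      have : 0 ≤ m * (1 - m) := mul_nonneg hm.1.le (by linarith [hm.2])
      have : 0 ≤ 7 / t₀ := by positivity
      gcongr
      nlinarith [sq_nonneg t]
    nlinarith
  · have htpos : 0 < t := by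
      by_contra! h'
      have : t = 0 := le_antisymm h' ht
      simp [this] at h
      linarith
    have hd : 0 < D * t := by positivity
    calc _ ≤ ∫⁻ _, 1 ∂medianLaw := by
          refine lintegral_mono_ae ?_
          filter_upwards [isPivotLaw_medianLaw.ae_mem] with m hm
          refine ENNReal.ofReal_le_one.2 (Real.exp_le_one_iff.2 ?_)
          -- For large `t` the integrand is at most one pointwise. With `H` the binary entropy, the
          -- exponent divided by `t` is at most `(-H + 2 / 7) / 2 - 1 + 12 / 7 * H = 17 / 14 * H - 6
          -- / 7`, negative since `H ≤ log 2`.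
          have key : ∀ u, 0 < u → u * Real.log (1 + D * (t * u))
              ≤ u * Real.log (D * t) + u * Real.log u + 1 / (D * t) := by
            intro u hu
            have e : 1 + D * (t * u) = D * t * u * (1 + 1 / (D * t * u)) := by field_simp; ring
            have h1 := Real.log_le_sub_one_of_pos (show 0 < 1 + 1 / (D * t * u) by positivity)
            rw [e, Real.log_mul (by positivity) (by positivity),
              Real.log_mul (by positivity) (by positivity)]
            have h2 : u * (1 / (D * t * u)) = 1 / (D * t) := by field_simp
            nlinarith
          have k1 := key m hm.1
          have k2 := key (1 - m) (by linarith [hm.2])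
          have k3 : Real.log (D * t) ≤ Real.log (1 + D * t) :=
            Real.log_le_log hd (by linarith)
          have k4 : 1 / (D * t) ≤ 1 / 7 := by gcongr
          have k5 := Real.binEntropy_le_log_two (p := m)
          have k6 := Real.log_two_lt_d9
          have k7 : m * Real.log m + (1 - m) * Real.log (1 - m) = -Real.binEntropy m := by
            simp [Real.binEntropy]; ring
          have k8 : m * Real.log (1 + D * (t * m))
              + (1 - m) * Real.log (1 + D * (t * (1 - m))) - Real.log (1 + D * t)
              ≤ -Real.binEntropy m + 2 / 7 := by linarith
          have k9 : 1 / 2 * (m * Real.log (1 + D * (t * m))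
              + (1 - m) * Real.log (1 + D * (t * (1 - m))) - Real.log (1 + D * t))
              - medianQuicksortToll m ≤ 0 := by
            rw [medianQuicksortToll_eq]
            linarith
          have := mul_nonpos_of_nonneg_of_nonpos ht k9
          linarith
      _ = 1 := by simp

theorem IsMedianQuicksortLaw.exists_left_tail_le {X : Measure ℝ} (hX : IsMedianQuicksortLaw X) :
    ∃ η > 0, ∀ᶠ x : ℝ in atTop, X.real (Iio (-x)) ≤ Real.exp (-(η * Real.exp (2 * x))) := by
  obtain ⟨A, hA, t₀, ht₀, hs⟩ := isPivotLaw_medianLaw.exists_lintegral_exp_le_one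
    continuous_medianQuicksortToll (fun m hm => abs_medianQuicksortToll_le hm)
    (IsCenteredFixedPoint.integral_toll hX isPivotLaw_medianLaw continuous_medianQuicksortToll)
  obtain ⟨D, hD, h⟩ := exists_left_exponent hA ht₀ hs
  -- This makes `D * t = exp (2 * x - 2) / 2`, hence `K t ≤ t * (x - 1)` and the Chernoff exponent
  -- is at most `-t`.
  set η := Real.exp (-2) / (2 * D) with hη
  have hη0 : 0 < η := by positivity
  refine ⟨η, hη0, ?_⟩
  filter_upwards [eventually_ge_atTop 2] with x hx
  set t := η * Real.exp (2 * x) with ht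
  have ht0 : 0 < t := by positivity
  have hb := IsCenteredFixedPoint.measureReal_lt_mul_le isPivotLaw_medianLaw
    continuous_medianQuicksortToll.measurable hX
    (K := fun t => 1 / 2 * t * Real.log (1 + D * t)) (fun t ht => by
      have : 0 ≤ Real.log (1 + D * t) := Real.log_nonneg (by nlinarith)
      positivity) (-1) h ht0.le x
  have e : {y : ℝ | x < -1 * y} = Iio (-x) := by
    ext y; simp; constructor <;> intro <;> linarith
  rw [e] at hb
  refine hb.trans (Real.exp_le_exp.2 ?_)
  have h1 : 1 + D * t ≤ Real.exp (2 * x - 2) := by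
    have : Real.exp (2 * x - 2) = 2 * (D * t) := by
      rw [ht, hη, sub_eq_add_neg, Real.exp_add]; field_simp
    have h2 := Real.add_one_le_exp (2 * x - 2)
    linarith
  have h2 : Real.log (1 + D * t) ≤ 2 * x - 2 :=
    (Real.log_le_log (by positivity) h1).trans (Real.log_exp _).le
  nlinarith

/-! ### Upper bound for the right tail -/

theorem setLIntegral_mul_exp_neg_le {B : ℝ} (hB : 0 < B) :
    ∫⁻ m in Ioo (0 : ℝ) 1, ENNReal.ofReal (m * Real.exp (-(B * m)))
      ≤ ENNReal.ofReal (1 / B ^ 2) := by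
  calc _ = ∫⁻ m in Ioo (0 : ℝ) 1, ENNReal.ofReal (1 / B ^ 2) * ProbabilityTheory.gammaPDF 2 B m := by
        refine setLIntegral_congr_fun measurableSet_Ioo fun m hm => ?_
        rw [ProbabilityTheory.gammaPDF_of_nonneg hm.1.le, ← ENNReal.ofReal_mul (by positivity)]
        congr 1
        have : (2 : ℝ) - 1 = 1 := by norm_num
        rw [this, Real.rpow_one, Real.rpow_two, Real.Gamma_two]
        field_simp
    _ ≤ ∫⁻ m, ENNReal.ofReal (1 / B ^ 2) * ProbabilityTheory.gammaPDF 2 B m :=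
        setLIntegral_le_lintegral _ _
    _ = _ := by
        rw [lintegral_const_mul' _ _ ENNReal.ofReal_ne_top,
          ProbabilityTheory.lintegral_gammaPDF_eq_one (by norm_num) hB, mul_one]

theorem setLIntegral_comp_one_sub (φ : ℝ → ENNReal) :
    ∫⁻ m in Ioo (0 : ℝ) 1, φ (1 - m) = ∫⁻ m in Ioo (0 : ℝ) 1, φ m := by
  have h := (Measure.measurePreserving_sub_left (volume : Measure ℝ)
    1).setLIntegral_comp_preimage_emb (Homeomorph.subLeft (1 : ℝ)).measurableEmbedding φ (Ioo 0 1)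
  have e : (fun x : ℝ => 1 - x) ⁻¹' Ioo 0 1 = Ioo 0 1 := by
    ext x; simp
  rwa [e] at h

/-- If `t * u ≤ 1`, the first factor is at least `t * u / 2` and the second is of order `exp (t /
2)`. Otherwise the first is at least `1 / 2` and the second at least `exp (t / 4) / 2`. -/
theorem exp_neg_mul_exp_sub_one_le {t u : ℝ} (ht : 4 ≤ t) (hu : 0 < u) (hu2 : u ≤ 1 / 2) :
    Real.exp (-((Real.exp (t * u / 2) - 1) * (Real.exp (t * (1 - u) / 2) - 1)))
      ≤ Real.exp (-(t * Real.exp (t / 2) / 8 * u)) + Real.exp (-(Real.exp (t / 4) / 4)) := by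
  have hv : t / 4 ≤ t * (1 - u) / 2 := by nlinarith
  have h1 : t * u / 2 ≤ Real.exp (t * u / 2) - 1 := by linarith [Real.add_one_le_exp (t * u / 2)]
  have h2 : Real.exp (t * (1 - u) / 2) / 2 ≤ Real.exp (t * (1 - u) / 2) - 1 := by
    linarith [Real.add_one_le_exp (t * (1 - u) / 2)]
  have htu : 0 ≤ t * u / 2 := by positivity
  rcases le_total (t * u) 1 with h | h
  · refine le_add_of_le_of_nonneg (Real.exp_le_exp.2 (neg_le_neg ?_)) (Real.exp_nonneg _)
    have h3 : Real.exp (t / 2) / 2 ≤ Real.exp (t * (1 - u) / 2) := by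
      have e : t * (1 - u) / 2 = t / 2 + -(t * u / 2) := by ring
      have := Real.add_one_le_exp (-(t * u / 2))
      rw [e, Real.exp_add, div_eq_mul_inv]
      gcongr
      linarith
    calc t * Real.exp (t / 2) / 8 * u = t * u / 2 * (Real.exp (t / 2) / 2 / 2) := by ring
      _ ≤ _ := mul_le_mul h1 (by linarith) (by positivity) (htu.trans h1)
  · refine le_add_of_nonneg_of_le (Real.exp_nonneg _) (Real.exp_le_exp.2 (neg_le_neg ?_))
    calc Real.exp (t / 4) / 4 = 1 / 2 * (Real.exp (t / 4) / 2) := by ring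
      _ ≤ (Real.exp (t * u / 2) - 1) * (Real.exp (t * (1 - u) / 2) / 2) := by
        refine mul_le_mul (by linarith) ?_ (by positivity) (htu.trans h1)
        gcongr
      _ ≤ _ := mul_le_mul_of_nonneg_left h2 (htu.trans h1)

/-- Near an endpoint the density contributes a factor `m`, so the integral there is at most `1 / B ^
2`, and `B ^ 2` is `exp t` times `t ^ 2 / 64`. This compensates the toll factor `exp t` exactly,
which is why `exp (t / 2)` is the right growth for `K`. -/
theorem lintegral_exp_medianLaw_le_one {t : ℝ} (ht : 256 ≤ t) :
    ∫⁻ m, ENNReal.ofReal (Real.exp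
      (-((Real.exp (t * m / 2) - 1) * (Real.exp (t * (1 - m) / 2) - 1))
        + t * medianQuicksortToll m)) ∂medianLaw ≤ 1 := by
  have hmeas := continuous_medianQuicksortToll.measurable
  set B := t * Real.exp (t / 2) / 8 with hB
  set R := Real.exp (-(Real.exp (t / 4) / 4)) with hR
  have hB0 : 0 < B := by positivity
  have hpt : ∀ m ∈ Ioo (0 : ℝ) 1, Real.exp
      (-((Real.exp (t * m / 2) - 1) * (Real.exp (t * (1 - m) / 2) - 1)))
      ≤ Real.exp (-(B * m)) + Real.exp (-(B * (1 - m))) + R := by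
    intro m hm
    rcases le_total m (1 / 2) with h | h
    · linarith [exp_neg_mul_exp_sub_one_le (t := t) (by linarith) hm.1 h,
        Real.exp_pos (-(B * (1 - m)))]
    · have := exp_neg_mul_exp_sub_one_le (t := t) (u := 1 - m) (by linarith) (by linarith [hm.2])
        (by linarith)
      rw [sub_sub_cancel, mul_comm (Real.exp _ - 1)] at this
      linarith [Real.exp_pos (-(B * m))]
  refine (lintegral_medianLaw_le (by fun_prop)).trans ?_
  calc _ ≤ 6 * ∫⁻ m in Ioo (0 : ℝ) 1, ENNReal.ofReal (Real.exp t) *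
        (ENNReal.ofReal (m * Real.exp (-(B * m)))
          + ENNReal.ofReal ((1 - m) * Real.exp (-(B * (1 - m)))) + ENNReal.ofReal R) := by
        gcongr 6 * ?_
        refine setLIntegral_mono' measurableSet_Ioo fun m hm => ?_
        have hm1 : 0 ≤ 1 - m := by linarith [hm.2]
        have hm0 := hm.1.le
        rw [← ENNReal.ofReal_add (by positivity) (by positivity),
          ← ENNReal.ofReal_add (by positivity) (by positivity),
          ← ENNReal.ofReal_mul (by positivity), ← ENNReal.ofReal_mul (by positivity)]
        refine ENNReal.ofReal_le_ofReal ?_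
        rw [Real.exp_add]
        have h1 : Real.exp (t * medianQuicksortToll m) ≤ Real.exp t := by
          refine Real.exp_le_exp.2 ?_
          have := (abs_le.1 (abs_medianQuicksortToll_le hm)).2
          nlinarith
        have h2 : m * (1 - m) * (Real.exp (-(B * m)) + Real.exp (-(B * (1 - m))) + R)
            ≤ m * Real.exp (-(B * m)) + (1 - m) * Real.exp (-(B * (1 - m))) + R := by
          have a1 : m * (1 - m) ≤ m := by nlinarith
          have a2 : m * (1 - m) ≤ 1 - m := by nlinarith
          have a3 : m * (1 - m) ≤ 1 := by nlinarith
          have b1 := mul_le_mul_of_nonneg_right a1 (Real.exp_nonneg (-(B * m)))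
          have b2 := mul_le_mul_of_nonneg_right a2 (Real.exp_nonneg (-(B * (1 - m))))
          have b3 := mul_le_mul_of_nonneg_right a3 (Real.exp_nonneg (-(Real.exp (t / 4) / 4)))
          linarith
        calc _ ≤ m * (1 - m) * ((Real.exp (-(B * m)) + Real.exp (-(B * (1 - m))) + R)
              * Real.exp t) := by
              gcongr
              exact hpt m hm
          _ = Real.exp t * (m * (1 - m) *
              (Real.exp (-(B * m)) + Real.exp (-(B * (1 - m))) + R)) := by ring
          _ ≤ _ := by gcongr
    _ ≤ 6 * (ENNReal.ofReal (Real.exp t) * (ENNReal.ofReal (1 / B ^ 2)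
          + ENNReal.ofReal (1 / B ^ 2) + ENNReal.ofReal R)) := by
        rw [lintegral_const_mul _ (by fun_prop), lintegral_add_left (by fun_prop),
          lintegral_add_left (by fun_prop),
          setLIntegral_comp_one_sub fun m => ENNReal.ofReal (m * Real.exp (-(B * m)))]
        gcongr
        · exact setLIntegral_mul_exp_neg_le hB0
        · exact setLIntegral_mul_exp_neg_le hB0
        · simp
    _ = ENNReal.ofReal (6 * (Real.exp t * (1 / B ^ 2 + 1 / B ^ 2 + R))) := by
        rw [ENNReal.ofReal_mul (by norm_num), ENNReal.ofReal_mul (by positivity),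
          ENNReal.ofReal_add (by positivity) (by positivity),
          ENNReal.ofReal_add (by positivity) (by positivity)]
        simp
    _ ≤ 1 := by
        refine ENNReal.ofReal_le_one.2 ?_
        have e1 : Real.exp t * (1 / B ^ 2) = 64 / t ^ 2 := by
          have : Real.exp t = Real.exp (t / 2) ^ 2 := by rw [← Real.exp_nat_mul]; congr 1; ring
          rw [hB, this]
          field_simp
          norm_num
        have e2 : Real.exp t * R ≤ 1 / 256 := by
          rw [hR, ← Real.exp_add]
          have h1 := Real.pow_div_factorial_le_exp (t / 4) (by positivity) 2
          have h2 : t + -(Real.exp (t / 4) / 4) ≤ -t := by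
            norm_num [Nat.factorial] at h1
            nlinarith
          have h3 := Real.add_one_le_exp t
          calc Real.exp (t + -(Real.exp (t / 4) / 4)) ≤ Real.exp (-t) := Real.exp_le_exp.2 h2
            _ = 1 / Real.exp t := by rw [Real.exp_neg, one_div]
            _ ≤ 1 / 256 := by gcongr; linarith
        have e3 : 64 / t ^ 2 ≤ 64 / 256 ^ 2 := by gcongr
        rw [mul_add (Real.exp t), mul_add (Real.exp t), e1]
        linarith

/-- Since `exp (t / 2)` is the product of the two partial exponentials, the increment of `K` is `-D
(a - 1) (b - 1)`. Small `t` reduces to the quadratic exponent, large `t` to the case `D = 1`, and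
the compact range between is handled by a large `D`. -/
theorem exists_right_exponent {A t₀ : ℝ} (hA : 0 < A) (ht₀ : 0 < t₀)
    (hsmall : ∀ t, |t| ≤ t₀ → ∫⁻ m, ENNReal.ofReal
      (Real.exp (-(A * t ^ 2 * (m * (1 - m))) + t * medianQuicksortToll m)) ∂medianLaw ≤ 1) :
    ∃ D > 0, ∀ t, 0 ≤ t → ∫⁻ m, ENNReal.ofReal (Real.exp
      (D * (Real.exp (t * m / 2) - 1) + D * (Real.exp (t * (1 - m) / 2) - 1)
        - D * (Real.exp (t / 2) - 1) + t * (1 * medianQuicksortToll m))) ∂medianLaw ≤ 1 := by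
  have hmeas := continuous_medianQuicksortToll.measurable
  set D := 1 + 4 * A + 24 * Real.exp 256 / t₀ ^ 2 with hD
  have hq : 0 < 24 * Real.exp 256 / t₀ ^ 2 := by positivity
  have hD0 : 0 < D := by positivity
  refine ⟨D, hD0, fun t ht => ?_⟩
  have e : ∀ m, D * (Real.exp (t * m / 2) - 1) + D * (Real.exp (t * (1 - m) / 2) - 1)
      - D * (Real.exp (t / 2) - 1) + t * (1 * medianQuicksortToll m)
      = -(D * ((Real.exp (t * m / 2) - 1) * (Real.exp (t * (1 - m) / 2) - 1)))
        + t * medianQuicksortToll m := by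
    intro m
    have : Real.exp (t / 2) = Real.exp (t * m / 2) * Real.exp (t * (1 - m) / 2) := by
      rw [← Real.exp_add]; congr 1; ring
    rw [this]; ring
  simp_rw [e]
  have hP : ∀ m ∈ Ioo (0 : ℝ) 1, t ^ 2 / 4 * (m * (1 - m))
      ≤ (Real.exp (t * m / 2) - 1) * (Real.exp (t * (1 - m) / 2) - 1) := by
    intro m hm
    have h0 := hm.1.le
    have h1 : 0 ≤ 1 - m := by linarith [hm.2]
    have h2 : 0 ≤ t * m / 2 := by positivity
    have h3 : 0 ≤ t * (1 - m) / 2 := by positivity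
    have h4 : t * m / 2 ≤ Real.exp (t * m / 2) - 1 := by
      linarith [Real.add_one_le_exp (t * m / 2)]
    have h5 : t * (1 - m) / 2 ≤ Real.exp (t * (1 - m) / 2) - 1 := by
      linarith [Real.add_one_le_exp (t * (1 - m) / 2)]
    calc _ = t * m / 2 * (t * (1 - m) / 2) := by ring
      _ ≤ _ := mul_le_mul h4 h5 h3 (h2.trans h4)
  rcases le_total t t₀ with h | h
  · refine le_trans (lintegral_mono_ae ?_) (hsmall t (by rwa [abs_of_nonneg ht]))
    filter_upwards [isPivotLaw_medianLaw.ae_mem] with m hm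
    refine ENNReal.ofReal_le_ofReal (Real.exp_le_exp.2 (add_le_add_left (neg_le_neg ?_) _))
    have h1 : 0 ≤ m * (1 - m) := mul_nonneg hm.1.le (by linarith [hm.2])
    calc A * t ^ 2 * (m * (1 - m)) = 4 * A * (t ^ 2 / 4 * (m * (1 - m))) := by ring
      _ ≤ D * (t ^ 2 / 4 * (m * (1 - m))) := by gcongr; linarith
      _ ≤ _ := mul_le_mul_of_nonneg_left (hP m hm) hD0.le
  rcases le_total t 256 with h' | h'
  · refine (lintegral_medianLaw_le (by fun_prop)).trans ?_
    calc _ ≤ 6 * ∫⁻ _ in Ioo (0 : ℝ) 1, ENNReal.ofReal (1 / 6) := by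
          gcongr 6 * ?_
          refine setLIntegral_mono' measurableSet_Ioo fun m hm => ?_
          have h1 : 0 < m * (1 - m) := mul_pos hm.1 (by linarith [hm.2])
          rw [← ENNReal.ofReal_mul h1.le]
          refine ENNReal.ofReal_le_ofReal ?_
          have h2 : t * medianQuicksortToll m ≤ 256 := by
            have := (abs_le.1 (abs_medianQuicksortToll_le hm)).2
            nlinarith
          have h3 : 6 * Real.exp 256 * (m * (1 - m))
              ≤ D * ((Real.exp (t * m / 2) - 1) * (Real.exp (t * (1 - m) / 2) - 1)) := by
            calc 6 * Real.exp 256 * (m * (1 - m))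
                = 24 * Real.exp 256 / t₀ ^ 2 * (t₀ ^ 2 / 4 * (m * (1 - m))) := by field_simp; ring
              _ ≤ D * (t ^ 2 / 4 * (m * (1 - m))) := by gcongr; linarith
              _ ≤ _ := mul_le_mul_of_nonneg_left (hP m hm) hD0.le
          calc _ ≤ m * (1 - m) * Real.exp (-(6 * Real.exp 256 * (m * (1 - m))) + 256) := by gcongr
            -- This is `z ≤ exp z` for `z = 6 * exp 256 * (m * (1 - m))`.
            _ ≤ 1 / 6 := by
              have h4 := Real.add_one_le_exp (6 * Real.exp 256 * (m * (1 - m)))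
              have h5 := Real.exp_pos (6 * Real.exp 256 * (m * (1 - m)))
              rw [Real.exp_add, Real.exp_neg, inv_mul_eq_div, ← mul_div_assoc,
                div_le_iff₀ h5]
              linarith
      _ = 1 := by
          rw [setLIntegral_const]
          norm_num [ENNReal.ofReal_div_of_pos, ENNReal.mul_inv_cancel]
  · refine le_trans (lintegral_mono_ae ?_) (lintegral_exp_medianLaw_le_one h')
    filter_upwards [isPivotLaw_medianLaw.ae_mem] with m hm
    refine ENNReal.ofReal_le_ofReal (Real.exp_le_exp.2 (add_le_add_left (neg_le_neg ?_) _))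
    refine le_mul_of_one_le_left ?_ (by linarith)
    exact le_trans (mul_nonneg (by positivity) (mul_nonneg hm.1.le (by linarith [hm.2]))) (hP m hm)

theorem IsMedianQuicksortLaw.exists_right_tail_le {X : Measure ℝ} (hX : IsMedianQuicksortLaw X) :
    ∃ D > 0, ∀ x, 1 ≤ x → X.real (Ioi x) ≤ Real.exp (-(2 * (x * Real.log x)) + D * x) := by
  obtain ⟨A, hA, t₀, ht₀, hs⟩ := isPivotLaw_medianLaw.exists_lintegral_exp_le_one
    continuous_medianQuicksortToll (fun m hm => abs_medianQuicksortToll_le hm)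
    (IsCenteredFixedPoint.integral_toll hX isPivotLaw_medianLaw continuous_medianQuicksortToll)
  obtain ⟨D, hD, h⟩ := exists_right_exponent hA ht₀ hs
  refine ⟨D, hD, fun x hx => ?_⟩
  have hb := IsCenteredFixedPoint.measureReal_lt_mul_le isPivotLaw_medianLaw
    -- No line.
    continuous_medianQuicksortToll.measurable hX
    (K := fun t => D * (Real.exp (t / 2) - 1)) (fun t ht => by
      have : 1 ≤ Real.exp (t / 2) := Real.one_le_exp (by positivity)
      exact mul_nonneg hD.le (by linarith)) 1 h (t := 2 * Real.log x)
      (mul_nonneg zero_le_two (Real.log_nonneg hx)) x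
  have e : {y : ℝ | x < 1 * y} = Ioi x := by ext y; simp
  rw [e] at hb
  refine hb.trans (Real.exp_le_exp.2 ?_)
  rw [mul_div_cancel_left₀ _ two_ne_zero, Real.exp_log (by linarith)]
  nlinarith

/-! ### Lower bounds for the tails -/

section

variable {μ F : Measure ℝ} {c : ℝ → ℝ}

theorem IsCenteredFixedPoint.mul_measureReal_le (hF : IsCenteredFixedPoint μ c F)
    [IsProbabilityMeasure μ] (hc : Measurable c) {I S T W : Set ℝ} (hW : MeasurableSet W)
    (h : ∀ m ∈ I, ∀ x ∈ S, ∀ y ∈ T, m * x + (1 - m) * y + c m ∈ W) :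
    μ.real I * (F.real S * F.real T) ≤ F.real W := by
  have := hF.isProbabilityMeasure
  have hm : Measurable fun p : ℝ × ℝ × ℝ => p.1 * p.2.1 + (1 - p.1) * p.2.2 + c p.1 :=
    measurable_smoothingMap hc
  rw [← measureReal_prod_prod, ← measureReal_prod_prod]
  conv_rhs => rw [← hF.fixed, smoothing, map_measureReal_apply hm hW]
  exact measureReal_mono fun p hp => h _ hp.1 _ hp.2.1 _ hp.2.2

theorem IsCenteredFixedPoint.measureReal_Ici_zero_pos (hF : IsCenteredFixedPoint μ c F) :
    0 < F.real (Ici 0) := by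
  have := hF.isProbabilityMeasure
  by_contra! h
  have h0 : F (Ici 0) = 0 := by
    simpa [measureReal_def, ENNReal.toReal_eq_zero_iff] using le_antisymm h measureReal_nonneg
  have hae : ∀ᵐ x ∂F, x < 0 := by
    rw [ae_iff]; convert h0 using 2; ext; simp
  have h1 := (integral_eq_zero_iff_of_nonneg_ae (μ := F) (f := fun x => -x)
    (by filter_upwards [hae] with x hx using by simpa using hx.le)
    (hF.memLp_two.integrable (by norm_num)).neg).1 (by rw [integral_neg, hF.mean_eq_zero, neg_zero])
  have h2 : ∀ᵐ x ∂F, False := by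
    filter_upwards [hae, h1] with x hx hx'
    simp at hx'
    exact hx.ne hx'
  simp at h2
  exact IsProbabilityMeasure.ne_zero F h2

theorem IsCenteredFixedPoint.measureReal_Iic_zero_pos (hF : IsCenteredFixedPoint μ c F) :
    0 < F.real (Iic 0) := by
  have := hF.isProbabilityMeasure
  by_contra! h
  have h0 : F (Iic 0) = 0 := by
    simpa [measureReal_def, ENNReal.toReal_eq_zero_iff] using le_antisymm h measureReal_nonneg
  have hae : ∀ᵐ x ∂F, 0 < x := by
    rw [ae_iff]; convert h0 using 2; ext; simp
  have h1 := (integral_eq_zero_iff_of_nonneg_ae (μ := F) (f := fun x => x)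
    (by filter_upwards [hae] with x hx using hx.le)
    (hF.memLp_two.integrable (by norm_num))).1 hF.mean_eq_zero
  have h2 : ∀ᵐ x ∂F, False := by
    filter_upwards [hae, h1] with x hx hx'
    simp at hx'
    exact hx.ne' hx'
  simp at h2
  exact IsProbabilityMeasure.ne_zero F h2

/-- One step to the right costs a power of the level, if the pivot is near one with a probability
of polynomial order. -/
theorem IsCenteredFixedPoint.exists_le_measureReal_Ici_add (hF : IsCenteredFixedPoint μ c F)
    [IsProbabilityMeasure μ] (hc : Continuous c) (hc1 : c 1 = 1) {k : ℕ}
    (hk : ∀ δ, 0 ≤ δ → δ ≤ 1 → ENNReal.ofReal (δ ^ k) ≤ μ (Icc (1 - δ) 1)) {r : ℝ} (hr : r < 1) :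
    ∃ a > 0, ∀ x, 0 ≤ x → a / (x + 1) ^ k * F.real (Ici x) ≤ F.real (Ici (x + r)) := by
  obtain ⟨ε, hε, hball⟩ := Metric.mem_nhds_iff.1
    (hc.continuousAt.preimage_mem_nhds (lt_mem_nhds (a := (1 + r) / 2) (b := c 1) (by linarith)))
  set η := min (min 1 (ε / 2)) ((1 - r) / 2) with hη
  have hη0 : 0 < η := lt_min (by positivity) (by linarith)
  have hη1 : η ≤ 1 := (min_le_left _ _).trans (min_le_left _ _)
  have hη2 : η ≤ ε / 2 := (min_le_left _ _).trans (min_le_right _ _)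
  have hη3 : η ≤ (1 - r) / 2 := min_le_right _ _
  have hq := hF.measureReal_Ici_zero_pos
  refine ⟨η ^ k * F.real (Ici 0), by positivity, fun x hx => ?_⟩
  have hδη : η / (x + 1) ≤ η := div_le_self hη0.le (by linarith)
  have hδx : η / (x + 1) * x ≤ η := by
    rw [div_mul_eq_mul_div, div_le_iff₀ (by linarith)]
    nlinarith
  have hδ0 : 0 ≤ η / (x + 1) := by positivity
  have h1 : (η / (x + 1)) ^ k ≤ μ.real (Icc (1 - η / (x + 1)) 1) := by
    have := hk (η / (x + 1)) hδ0 (hδη.trans hη1)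
    rwa [ENNReal.ofReal_le_iff_le_toReal (by finiteness)] at this
  have h2 := hF.mul_measureReal_le hc.measurable (I := Icc (1 - η / (x + 1)) 1) (S := Ici x)
    (T := Ici 0) (W := Ici (x + r)) measurableSet_Ici (by
      intro m hm y hy z hz
      simp only [mem_Icc, mem_Ici] at hm hy hz ⊢
      have hcm : (1 + r) / 2 < c m := hball (by
        rw [Metric.mem_ball, Real.dist_eq, abs_lt]
        constructor <;> linarith [hm.1, hm.2])
      have hm0 : 0 ≤ m := by linarith [hm.1]
      have a1 : m * x ≤ m * y := by gcongr
      have a2 : 0 ≤ (1 - m) * z := mul_nonneg (by linarith [hm.2]) hz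
      nlinarith [hm.1])
  calc _ = (η / (x + 1)) ^ k * (F.real (Ici x) * F.real (Ici 0)) := by rw [div_pow]; ring
    _ ≤ _ := by gcongr
    _ ≤ _ := h2

/-- About `x / r` steps of length `r` reach level `x`, each costing a factor of order `x ^ (-k)`, so
the exponent is `(k / r) x log x` to leading order. Any `r` strictly between `k / θ` and `1`
suffices. -/
theorem IsCenteredFixedPoint.eventually_exp_le_measureReal_Ioi (hF : IsCenteredFixedPoint μ c F)
    [IsProbabilityMeasure μ] (hc : Continuous c) (hc1 : c 1 = 1) {k : ℕ}
    (hk : ∀ δ, 0 ≤ δ → δ ≤ 1 → ENNReal.ofReal (δ ^ k) ≤ μ (Icc (1 - δ) 1)) {θ : ℝ} (hθ : k < θ) :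
    ∀ᶠ x : ℝ in atTop, Real.exp (-(θ * (x * Real.log x))) ≤ F.real (Ioi x) := by
  have := hF.isProbabilityMeasure
  have hθ0 : 0 < θ := lt_of_le_of_lt (Nat.cast_nonneg k) hθ
  set r := (k / θ + 1) / 2 with hr
  have hkθ : k / θ < 1 := (div_lt_one hθ0).2 hθ
  have hkθ0 : 0 ≤ k / θ := by positivity
  have hr0 : 0 < r := by positivity
  have hr1 : r < 1 := by linarith
  have hkr : k * (1 / r) < θ := by
    rw [mul_one_div, div_lt_iff₀ hr0, ← div_lt_iff₀' hθ0]; linarith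
  obtain ⟨a, ha, hstep⟩ := hF.exists_le_measureReal_Ici_add hc hc1 hk hr1
  set q := F.real (Ici 0) with hq
  have hq0 : 0 < q := hF.measureReal_Ici_zero_pos
  have hiter : ∀ n : ℕ, q * (a / ((n : ℝ) + 1) ^ k) ^ n ≤ F.real (Ici (n * r)) := by
    intro n
    induction n with
    | zero => simp [hq]
    | succ n ih =>
      have h1 := hstep (n * r) (by positivity)
      rw [show (n : ℝ) * r + r = ((n + 1 : ℕ) : ℝ) * r by push_cast; ring] at h1
      refine le_trans ?_ h1
      have h2 : a / (((n + 1 : ℕ) : ℝ) + 1) ^ k ≤ a / (n * r + 1) ^ k := by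
        gcongr
        push_cast
        nlinarith [Nat.cast_nonneg (α := ℝ) n]
      have h3 : a / (((n + 1 : ℕ) : ℝ) + 1) ^ k ≤ a / ((n : ℝ) + 1) ^ k := by
        gcongr
        linarith
      calc _ = a / (((n + 1 : ℕ) : ℝ) + 1) ^ k * (q * (a / (((n + 1 : ℕ) : ℝ) + 1) ^ k) ^ n) := by
            ring
        _ ≤ a / (n * r + 1) ^ k * (q * (a / ((n : ℝ) + 1) ^ k) ^ n) := by gcongr
        _ ≤ _ := by gcongr
  set E := k * Real.log (1 / r + 2) + |Real.log a| + |Real.log q| with hE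
  have hlow : ∀ x, 1 ≤ x →
      Real.exp (-((x / r + 1) * (k * Real.log x + E))) ≤ F.real (Ioi x) := by
    intro x hx
    set n := ⌊x / r⌋₊ + 1 with hn
    have hxr : 0 ≤ x / r := by positivity
    have hn1 : (n : ℝ) ≤ x / r + 1 := by
      rw [hn]; push_cast; linarith [Nat.floor_le hxr]
    have hn2 : x / r < n := by
      rw [hn]; push_cast; exact Nat.lt_floor_add_one _
    have hn0 : (1 : ℝ) ≤ n := by rw [hn]; push_cast; linarith [Nat.cast_nonneg (α := ℝ) ⌊x / r⌋₊]
    have hsub : Ici (n * r) ⊆ Ioi x := fun y hy => ((div_lt_iff₀ hr0).1 hn2).trans_le hy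
    refine le_trans ?_ ((hiter n).trans (measureReal_mono hsub))
    have hlogn : Real.log (n + 1) ≤ Real.log x + Real.log (1 / r + 2) := by
      rw [← Real.log_mul (by positivity) (by positivity)]
      refine Real.log_le_log (by positivity) ?_
      have : x * (1 / r + 2) = x / r + 2 * x := by ring
      linarith
    rw [← Real.exp_log (show 0 < q * (a / ((n : ℝ) + 1) ^ k) ^ n by positivity)]
    refine Real.exp_le_exp.2 ?_
    rw [Real.log_mul (by positivity) (by positivity), Real.log_pow,
      Real.log_div (by positivity) (by positivity), Real.log_pow]
    have b1 := neg_abs_le (Real.log a)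
    have b2 := neg_abs_le (Real.log q)
    have b3 : |Real.log q| ≤ n * |Real.log q| := le_mul_of_one_le_left (abs_nonneg _) hn0
    have b4 : (k : ℝ) * Real.log (n + 1) ≤ k * (Real.log x + Real.log (1 / r + 2)) := by gcongr
    have b5 : 0 ≤ (k : ℝ) * Real.log (n + 1) :=
      mul_nonneg (Nat.cast_nonneg k) (Real.log_nonneg (by linarith))
    have b6 : 0 ≤ k * Real.log x + E := by
      have := abs_nonneg (Real.log a)
      have := abs_nonneg (Real.log q)
      linarith
    have b7 : (n : ℝ) * (k * Real.log x + E) ≤ (x / r + 1) * (k * Real.log x + E) := by gcongr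
    have b8 : (n : ℝ) * (k * Real.log (n + 1) + |Real.log a| + |Real.log q|)
        ≤ n * (k * Real.log x + E) := mul_le_mul_of_nonneg_left (by linarith) (by linarith)
    have b9 : (n : ℝ) * (-|Real.log a|) ≤ n * Real.log a := by gcongr
    linarith
  have hlim : Tendsto (fun x : ℝ => (1 / r + x⁻¹) * (k + E * (Real.log x)⁻¹)) atTop
      (𝓝 ((1 / r + 0) * (k + E * 0))) :=
    (tendsto_inv_atTop_zero.const_add _).mul
      (((tendsto_inv_atTop_zero.comp Real.tendsto_log_atTop).const_mul _).const_add _)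
  have hlt : (1 / r + 0) * (k + E * 0) < θ := by linarith
  filter_upwards [hlim.eventually_lt_const hlt, eventually_gt_atTop 1] with x hx hx1
  refine le_trans (Real.exp_le_exp.2 (neg_le_neg ?_)) (hlow x hx1.le)
  have hlog : 0 < Real.log x := Real.log_pos hx1
  calc (x / r + 1) * (k * Real.log x + E)
      = (1 / r + x⁻¹) * (k + E * (Real.log x)⁻¹) * (x * Real.log x) := by field_simp
    _ ≤ θ * (x * Real.log x) := by gcongr

end

theorem IsMedianQuicksortLaw.eventually_exp_le {X : Measure ℝ} (hX : IsMedianQuicksortLaw X)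
    {θ : ℝ} (hθ : 2 < θ) :
    ∀ᶠ x : ℝ in atTop, Real.exp (-(θ * (x * Real.log x))) ≤ X.real (Ioi x) :=
  IsCenteredFixedPoint.eventually_exp_le_measureReal_Ioi hX continuous_medianQuicksortToll
    (by simp [medianQuicksortToll]) (fun _ => le_medianLaw_Icc_one_sub) (by exact_mod_cast hθ)

theorem IsQuicksortLaw.eventually_exp_le {Q : Measure ℝ} (hQ : IsQuicksortLaw Q)
    {θ : ℝ} (hθ : 1 < θ) :
    ∀ᶠ x : ℝ in atTop, Real.exp (-(θ * (x * Real.log x))) ≤ Q.real (Ioi x) :=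
  IsCenteredFixedPoint.eventually_exp_le_measureReal_Ioi hQ continuous_quicksortToll
    (by simp [quicksortToll]) (k := 1)
    (fun δ _ h1 => by simpa using le_uniformLaw_Icc_one_sub h1) (by exact_mod_cast hθ)

/-- With a pivot near one half the toll is below `-b`, so two copies below `-x` give a value below
`-(x + b)`. Each step of length `b` squares the probability up to a constant, whence `γ = log 2 /
b`. -/
theorem IsQuicksortLaw.exists_le_left_tail {Q : Measure ℝ} (hQ : IsQuicksortLaw Q) :
    ∃ B > 0, ∃ γ, 0 < γ ∧ γ < 2 ∧ ∀ x, 0 ≤ x →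
      Real.exp (-(B * Real.exp (γ * x))) ≤ Q.real (Iio (-x)) := by
  have := hQ.isProbabilityMeasure
  -- Any value strictly between `log 2 / 2` (for `γ < 2`) and `2 * log 2 - 1` (minus the toll at one
  -- half) would do.
  set b : ℝ := 9 / 25 with hb
  set S : Set ℝ := Ioo 0 1 ∩ quicksortToll ⁻¹' Iio (-b) with hS
  have hSo : IsOpen S := isOpen_Ioo.inter (isOpen_Iio.preimage continuous_quicksortToll)
  have hSn : S.Nonempty := by
    refine ⟨1 / 2, ⟨by norm_num, by norm_num⟩, ?_⟩
    have h1 := Real.log_two_gt_d9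
    rw [mem_preimage, quicksortToll_eq, one_div, Real.binEntropy_two_inv, mem_Iio, hb]
    linarith
  set a := uniformLaw.real S with ha
  have ha0 : 0 < a := by
    refine ENNReal.toReal_pos ?_ (by finiteness)
    rw [uniformLaw, Measure.restrict_apply hSo.measurableSet,
      inter_eq_left.2 (inter_subset_left : S ⊆ Ioo 0 1)]
    exact (hSo.measure_pos volume hSn).ne'
  have ha1 : a ≤ 1 := measureReal_le_one
  set q := Q.real (Iic 0) with hq
  have hq0 : 0 < q := IsCenteredFixedPoint.measureReal_Iic_zero_pos hQ
  have hq1 : q ≤ 1 := measureReal_le_one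
  have hstep : ∀ x, a * (Q.real (Iic (-x)) * Q.real (Iic (-x))) ≤ Q.real (Iic (-(x + b))) := by
    intro x
    refine IsCenteredFixedPoint.mul_measureReal_le hQ continuous_quicksortToll.measurable
      measurableSet_Iic ?_
    rintro m ⟨hm, hm'⟩ y hy z hz
    simp only [mem_preimage, mem_Iio, mem_Iic] at hm' hy hz ⊢
    have a1 : m * y ≤ m * -x := mul_le_mul_of_nonneg_left hy hm.1.le
    have a2 : (1 - m) * z ≤ (1 - m) * -x := mul_le_mul_of_nonneg_left hz (by linarith [hm.2])
    linarith
  -- The extra factor `a` turns the recursion `a * p ^ 2 ≤ p'` into pure squaring.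
  have hiter : ∀ n : ℕ, (a * q) ^ 2 ^ n ≤ a * Q.real (Iic (-(n * b))) := by
    intro n
    induction n with
    | zero => simp [hq]
    | succ n ih =>
      have h1 := hstep (n * b)
      rw [show (n : ℝ) * b + b = ((n + 1 : ℕ) : ℝ) * b by push_cast; ring] at h1
      calc _ = (a * q) ^ 2 ^ n * (a * q) ^ 2 ^ n := by rw [pow_succ, pow_mul, sq]
        _ ≤ (a * Q.real (Iic (-(n * b)))) * (a * Q.real (Iic (-(n * b)))) := by gcongr
        _ = a * (a * (Q.real (Iic (-(n * b))) * Q.real (Iic (-(n * b))))) := by ring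
        _ ≤ _ := by gcongr
  have haq : 0 < a * q := by positivity
  have haq1 : a * q ≤ 1 := mul_le_one₀ ha1 hq0.le hq1
  have hB0 : 0 ≤ -Real.log (a * q) := by linarith [Real.log_nonpos haq.le haq1]
  refine ⟨2 * -Real.log (a * q) + 1, by positivity, Real.log 2 / b, by positivity, ?_, fun x hx => ?_⟩
  · rw [div_lt_iff₀ (by norm_num [hb]), hb]
    linarith [Real.log_two_lt_d9]
  have hb0 : 0 < b := by norm_num [hb]
  set n := ⌊x / b⌋₊ + 1 with hn
  have hxb : 0 ≤ x / b := by positivity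
  have hn2 : x / b < n := by
    rw [hn]; push_cast; exact Nat.lt_floor_add_one _
  have hsub : Iic (-(n * b)) ⊆ Iio (-x) := fun y hy =>
    lt_of_le_of_lt hy (neg_lt_neg ((div_lt_iff₀ hb0).1 hn2))
  refine le_trans ?_ (measureReal_mono hsub)
  refine le_trans ?_ ((hiter n).trans (mul_le_of_le_one_left measureReal_nonneg ha1))
  have hpow : (2 : ℝ) ^ n ≤ 2 * Real.exp (Real.log 2 / b * x) := by
    rw [hn, pow_succ, mul_comm, ← Real.rpow_natCast, Real.rpow_def_of_pos two_pos]
    refine mul_le_mul_of_nonneg_left (Real.exp_le_exp.2 ?_) two_pos.le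
    rw [div_mul_eq_mul_div, mul_div_assoc]
    exact mul_le_mul_of_nonneg_left (Nat.floor_le hxb) (Real.log_nonneg one_le_two)
  rw [← Real.exp_log haq, ← Real.exp_nat_mul, Real.log_exp]
  refine Real.exp_le_exp.2 ?_
  push_cast
  have := mul_le_mul_of_nonneg_right hpow hB0
  have := Real.exp_pos (Real.log 2 / b * x)
  linarith

/-! ### Comparison of the tails -/

theorem mainTheorem6 (X : Measure ℝ) (hX : IsMedianQuicksortLaw X) :
    Tendsto (fun x : ℝ => ENNReal.log (X (Ioi x)) / ((x * Real.log x : ℝ) : EReal))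
        atTop (𝓝 ((-2 : ℝ) : EReal)) ∧
      limsup (fun x : ℝ => ENNReal.log (X (Iio (-x))) / ((x * Real.log x : ℝ) : EReal)) atTop
        ≤ ((-(14 / (12 * Real.log 2 - 7)) : ℝ) : EReal) ∧
      ∀ Q : Measure ℝ, IsQuicksortLaw Q →
        (fun x : ℝ => X.real (Ioi x)) =o[atTop] (fun x : ℝ => Q.real (Ioi x)) ∧
        (fun x : ℝ => X.real (Iio (-x))) =o[atTop] (fun x : ℝ => Q.real (Iio (-x))) := by
  have := hX.isProbabilityMeasure
  obtain ⟨D, hD, hright⟩ := hX.exists_right_tail_le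
  obtain ⟨η, hη, hleft⟩ := hX.exists_left_tail_le
  have hlog_real (S : Set ℝ) (hS : 0 < X.real S) :
      ENNReal.log (X S) = ((Real.log (X.real S) : ℝ) : EReal) := by
    rw [← ENNReal.log_ofReal_of_pos hS, ofReal_measureReal]
  have hpos : ∀ᶠ x : ℝ in atTop, 0 < X.real (Ioi x) := by
    filter_upwards [hX.eventually_exp_le (θ := 3) (by norm_num)] with x hx
    exact (Real.exp_pos _).trans_le hx
  refine ⟨?_, ?_, fun Q hQ => ⟨?_, ?_⟩⟩
  · have hreal : Tendsto (fun x : ℝ => Real.log (X.real (Ioi x)) / (x * Real.log x)) atTop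
        (𝓝 (-2)) := by
      refine tendsto_order.2 ⟨fun y hy => ?_, fun y hy => ?_⟩
      · filter_upwards [hX.eventually_exp_le (θ := (2 - y) / 2) (by linarith),
          eventually_gt_atTop 1] with x hx hx1
        have hl := Real.log_pos hx1
        have hxl : 0 < x * Real.log x := by positivity
        rw [lt_div_iff₀ hxl]
        have h := Real.log_le_log (Real.exp_pos _) hx
        rw [Real.log_exp] at h
        nlinarith
      · have hlim : Tendsto (fun x : ℝ => -2 + D * (Real.log x)⁻¹) atTop (𝓝 (-2 + D * 0)) :=
          ((tendsto_inv_atTop_zero.comp Real.tendsto_log_atTop).const_mul _).const_add _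
        filter_upwards [hlim.eventually_lt_const (u := y) (by linarith), hpos,
          eventually_gt_atTop 1] with x hx hp hx1
        have hl := Real.log_pos hx1
        have hxl : 0 < x * Real.log x := by positivity
        refine lt_of_le_of_lt ?_ hx
        rw [div_le_iff₀ hxl]
        have h := Real.log_le_log hp (hright x hx1.le)
        rw [Real.log_exp] at h
        refine h.trans (le_of_eq ?_)
        field_simp
    refine ((continuous_coe_real_ereal.tendsto _).comp hreal).congr' ?_
    filter_upwards [hpos] with x hp
    rw [hlog_real _ hp, ← EReal.coe_div]
    rfl
  · refine limsup_le_of_le (by isBoundedDefault) ?_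
    set G := 14 / (12 * Real.log 2 - 7) with hG
    have hG0 : 0 < G := by
      have := Real.log_two_gt_d9
      exact div_pos (by norm_num) (by linarith)
    -- The doubly exponential bound beats `G * x ^ 2`, hence `G * x * log x`, so the particular
    -- value of `G` plays no role beyond its sign.
    have hlim := tendsto_exp_mul_div_rpow_atTop 2 2 two_pos
    filter_upwards [hleft, eventually_gt_atTop 1, hlim.eventually_ge_atTop (G / η)]
      with x hx hx1 hxG
    have hl := Real.log_pos hx1
    have hxl : 0 < x * Real.log x := by positivity
    have h1 : ENNReal.log (X (Iio (-x))) ≤ ((-(η * Real.exp (2 * x)) : ℝ) : EReal) := by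
      rw [← ofReal_measureReal (μ := X) (s := Iio (-x)), ← Real.log_exp (-(η * Real.exp (2 * x))),
        ← ENNReal.log_ofReal_of_pos (Real.exp_pos _)]
      exact ENNReal.log_monotone (ENNReal.ofReal_le_ofReal hx)
    refine (EReal.div_le_div_right_of_nonneg (by exact_mod_cast hxl.le) h1).trans ?_
    rw [← EReal.coe_div, EReal.coe_le_coe_iff, div_le_iff₀ hxl]
    rw [Real.rpow_two, div_le_div_iff₀ hη (by positivity)] at hxG
    have h2 : x * Real.log x ≤ x ^ 2 := by
      have := Real.log_le_sub_one_of_pos (show 0 < x by linarith)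
      nlinarith
    have h3 : G * (x * Real.log x) ≤ G * x ^ 2 := by gcongr
    linarith
  · have h1 : (fun x : ℝ => X.real (Ioi x)) =O[atTop]
        fun x => Real.exp (-(2 * (x * Real.log x)) + D * x) := by
      refine IsBigO.of_bound' ?_
      filter_upwards [eventually_ge_atTop 1] with x hx
      rw [Real.norm_of_nonneg measureReal_nonneg, Real.norm_of_nonneg (Real.exp_nonneg _)]
      exact hright x hx
    -- The value `3 / 2` separates the Quicksort constant `1` from the median-of-three constant `2`.
    have h2 : (fun x : ℝ => Real.exp (-(3 / 2 * (x * Real.log x)))) =O[atTop]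
        fun x => Q.real (Ioi x) := by
      refine IsBigO.of_bound' ?_
      filter_upwards [hQ.eventually_exp_le (θ := 3 / 2) (by norm_num)] with x hx
      rwa [Real.norm_of_nonneg measureReal_nonneg, Real.norm_of_nonneg (Real.exp_nonneg _)]
    refine (h1.trans_isLittleO (Real.isLittleO_exp_comp_exp_comp.2 ?_)).trans_isBigO h2
    have : Tendsto (fun x : ℝ => x * (1 / 2 * Real.log x + -D)) atTop atTop :=
      tendsto_id.atTop_mul_atTop₀ (tendsto_atTop_add_const_right _ _
        (Real.tendsto_log_atTop.const_mul_atTop (by norm_num)))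
    refine this.congr fun x => ?_
    ring
  · obtain ⟨B, hB, γ, hγ0, hγ, hlow⟩ := hQ.exists_le_left_tail
    have h1 : (fun x : ℝ => X.real (Iio (-x))) =O[atTop]
        fun x => Real.exp (-(η * Real.exp (2 * x))) := by
      refine IsBigO.of_bound' ?_
      filter_upwards [hleft] with x hx
      rwa [Real.norm_of_nonneg measureReal_nonneg, Real.norm_of_nonneg (Real.exp_nonneg _)]
    have h2 : (fun x : ℝ => Real.exp (-(B * Real.exp (γ * x)))) =O[atTop]
        fun x => Q.real (Iio (-x)) := by
      refine IsBigO.of_bound' ?_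
      filter_upwards [eventually_ge_atTop 0] with x hx
      rw [Real.norm_of_nonneg measureReal_nonneg, Real.norm_of_nonneg (Real.exp_nonneg _)]
      exact hlow x hx
    refine (h1.trans_isLittleO (Real.isLittleO_exp_comp_exp_comp.2 ?_)).trans_isBigO h2
    have : Tendsto (fun x : ℝ => Real.exp (γ * x) * (η * Real.exp ((2 - γ) * x) + -B))
        atTop atTop := by
      have hexp {β : ℝ} (hβ : 0 < β) : Tendsto (fun x : ℝ => Real.exp (β * x)) atTop atTop :=
        Real.tendsto_exp_atTop.comp (tendsto_id.const_mul_atTop hβ)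
      exact (hexp hγ0).atTop_mul_atTop₀ (tendsto_atTop_add_const_right _ _
        ((hexp (by linarith)).const_mul_atTop hη))
    refine this.congr fun x => ?_
    have e : Real.exp (2 * x) = Real.exp (γ * x) * Real.exp ((2 - γ) * x) := by
      rw [← Real.exp_add]; congr 1; ring
    rw [e]
    ring
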